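/- Notation. Let $\Delta=\{z\in\mathbb C:|z|<1\}$. Let $L$ be the class of continuous functions $\alpha:\mathbb R\to[0,+\infty)$ for which there is $x_0\in\mathbb R$ such that $\alpha(x)=\alpha(x_0)$ for $x\le x_0$ and $\alpha$ increases (not necessarily strictly) to $+\infty$ on $[x_0,+\infty)$. Let $L_1$ be the class of $\alpha\in L$ for which there are $c>0$ and $R_0$ with $\alpha(a+b)\le\alpha(a)+\alpha(b)+c$ for all $a,b\ge R_0$; $L_2$ the class of $\beta\in L$ with $\beta(x+O(1))=(1+o(1))\beta(x)$ as $x\to+\infty$; and $L_3$ the class of $\gamma\in L$ for which there is $R_0$ with $\gamma(a+b)\le\gamma(a)+\gamma(b)$ for all $a,b\ge R_0$. Put $\alpha^{-1}(y)=\inf\{x:\alpha(x)\ge y\}$ (for large $y$ this is the usual inverse if $\alpha$ is strictly increasing on $[x_0,+\infty)$), and let $\log^{[p]}$ be the $p$-fold iterated logarithm. For $f$ meromorphic in $\Delta$ let $T(r,f)=m(r,f)+N(r,f)$, $0<r<1$, be its Nevanlinna characteristic, where $m(r,f)=\frac1{2\pi}\int_0^{2\pi}\log^+|f(re^{i\theta})|\,d\theta$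 and $N(r,f)=\sum_{0<|b|\le r}n_b\log\frac r{|b|}+n_0\log r$, $n_b$ being the multiplicity of $b$ as a pole of $f$ ($n_b=0$ if $b$ is not a pole). Define, with values in $[0,+\infty]$, $$\varrho_{(\alpha,\beta,\gamma)}[f]=\limsup_{r\to1^-}\frac{\alpha(\log T(r,f))}{\beta\left(\log\gamma\left(\frac1{1-r}\right)\right)},\qquad \varrho_{(\alpha(\log),\beta,\gamma)}[f]=\limsup_{r\to1^-}\frac{\alpha(\log^{[2]} T(r,f))}{\beta\left(\log\gamma\left(\frac1{1-r}\right)\right)},$$ where each logarithm applied to $T$ is read as $\log^+=\max\{0,\log\}$, with $\log^+ x=0$ for $x\le 0$. Lemma. Let $\alpha\in L_1$, $\beta\in L_2$, $\gamma\in L_3$ satisfy, as $x\to+\infty$, $\alpha(\log^{[p]}x)=o(\beta(\log\gamma(x)))$ for every integer $p\ge2$, $\alpha(\log x)=o(\alpha(x))$, and $\alpha^{-1}(kx)=o(\alpha^{-1}(x))$ for every $0\le k<1$. Let $f$ be a meromorphic function in $\Delta$. Then $$\varrho_{(\alpha,\beta,\gamma)}[f']=\varrho_{(\alpha,\beta,\gamma)}[f]\qquad\text{and}\qquad\varrho_{(\alpha(\log),\beta,\gamma)}[f']=\varrho_{(\alpha(\log),\beta,\gamma)}[f].$$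 -/

import Mathlib

open Filter Topology Asymptotics

/-- The class `L`: continuous non-negative functions on `ℝ`, constant on some `(-∞, x₀]` and
increasing to `+∞` on `[x₀, +∞)` (strict increase is not required). -/
structure ClassL (α : ℝ → ℝ) : Prop where
  continuous : Continuous α
  nonneg : ∀ x, 0 ≤ α x
  exists_const_increasing : ∃ x₀ : ℝ, (∀ x ≤ x₀, α x = α x₀) ∧ MonotoneOn α (Set.Ici x₀)
  tendsto_atTop : Tendsto α atTop atTop

/-- The class `L₁`: functions of `L` with `α (a + b) ≤ α a + α b + c` for all large `a`, `b`. -/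
structure ClassL1 (α : ℝ → ℝ) : Prop extends ClassL α where
  almost_subadditive :
    ∃ c > 0, ∃ R₀ : ℝ, ∀ a b, R₀ ≤ a → R₀ ≤ b → α (a + b) ≤ α a + α b + c

/-- The class `L₂`: functions of `L` with `β (x + O(1)) = (1 + o(1)) β x` as `x → +∞`. -/
structure ClassL2 (β : ℝ → ℝ) : Prop extends ClassL β where
  shift : ∀ h : ℝ → ℝ, h =O[atTop] (fun _ => (1 : ℝ)) → (fun x => β (x + h x)) ~[atTop] β

/-- The class `L₃`: functions of `L` that are subadditive for large arguments. -/
structure ClassL3 (γ : ℝ → ℝ) : Prop extends ClassL γ where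
  subadditive : ∃ R₀ : ℝ, ∀ a b, R₀ ≤ a → R₀ ≤ b → γ (a + b) ≤ γ a + γ b

/-- The inverse `α⁻¹ (y) = inf {x | y ≤ α x}` of a function of the class `L`. For `y > α x₀`, and
hence for all large `y`, it is the ordinary inverse when `α` is strictly increasing on
`[x₀, +∞)`. -/
noncomputable def growthInv (α : ℝ → ℝ) (y : ℝ) : ℝ := sInf {x : ℝ | y ≤ α x}

/-- The standing assumptions on the triple `(α, β, γ)`. -/
structure GrowthTriple (α β γ : ℝ → ℝ) : Prop where
  left : ClassL1 α
  middle : ClassL2 β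
  right : ClassL3 γ
  iterated_log : ∀ p : ℕ, 2 ≤ p →
    (fun x => α (Real.log^[p] x)) =o[atTop] (fun x => β (Real.log (γ x)))
  log_isLittleO : (fun x => α (Real.log x)) =o[atTop] α
  inv_isLittleO : ∀ k : ℝ, 0 ≤ k → k < 1 →
    (fun x => growthInv α (k * x)) =o[atTop] (growthInv α)

/-- The integrated counting function of the poles of `f` in `|z| ≤ r`,
`N(r, f) = ∑_{0 < |b| ≤ r} n_b log (r / |b|) + n_0 log r`, where `n_b` is the multiplicity of `b` as
a pole of `f`. It equals `∫₀ʳ (n(t, f) - n(0, f)) dt / t + n(0, f) log r`. (Mathlib's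
`ValueDistribution.logCounting` is only meaningful for functions meromorphic in all of `ℂ`. The
term `u = 0` of the sum vanishes, since `0⁻¹ = 0` and `log 0 = 0`.) -/
noncomputable def poleCounting (f : ℂ → ℂ) (r : ℝ) : ℝ :=
  ∑ᶠ u : ℂ, (((MeromorphicOn.divisor f (Metric.closedBall 0 |r|))⁻ u : ℤ) : ℝ)
      * Real.log (r * ‖u‖⁻¹)
    + (((MeromorphicOn.divisor f (Metric.closedBall 0 |r|))⁻ 0 : ℤ) : ℝ) * Real.log r

/-- The Nevanlinna characteristic `T(r, f) = m(r, f) + N(r, f)`, where `m(r, f)` is the mean of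
`log⁺ |f|` over the circle `|z| = r`. -/
noncomputable def nevanlinnaT (f : ℂ → ℂ) (r : ℝ) : ℝ :=
  ValueDistribution.proximity f ⊤ r + poleCounting f r

/-- The `(α, β, γ)`-order `limsup_{r → 1⁻} α (log T(r, f)) / β (log γ (1 / (1 - r)))`, an extended
real number. The logarithm of `T` is cut off at `0`, so that it is defined for all values of `T`;
this affects only the `r` with `T(r, f) < 1`, where `α (log T)` is bounded, while the denominator
tends to infinity, and so does not change the upper limit. -/
noncomputable def growthOrder (α β γ : ℝ → ℝ) (f : ℂ → ℂ) : EReal :=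
  limsup (fun r : ℝ =>
    ((α (Real.posLog (nevanlinnaT f r)) / β (Real.log (γ (1 / (1 - r)))) : ℝ) : EReal)) (𝓝[<] 1)

/-- The `(α(log), β, γ)`-order
`limsup_{r → 1⁻} α (log log T(r, f)) / β (log γ (1 / (1 - r)))`, an extended real number. The
logarithms of the numerator are cut off at `0` as in `growthOrder`. -/
noncomputable def growthOrderLog (α β γ : ℝ → ℝ) (f : ℂ → ℂ) : EReal :=
  limsup (fun r : ℝ =>
    ((α (Real.posLog (Real.posLog (nevanlinnaT f r))) / β (Real.log (γ (1 / (1 - r)))) : ℝ)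
      : EReal)) (𝓝[<] 1)

/-! Put R = (1 + r)/2. Both equalities follow from two estimates, one in each direction: T(r, f) ≤ C
log(4/(1 - r)) (|T(R, f')| + C), and the same with f and f' exchanged
(`logComparable_nevanlinnaT_deriv`, `logComparable_deriv_nevanlinnaT`). One logarithm turns the
extra factor into log log(1/(1 - r)) + O(1), two turn it into a triple iterated logarithm. Since α
is subadditive up to a constant, these errors are negligible against the denominator. Passing from r
to R doubles 1/(1 - r), which changes the denominator by a factor 1 + o(1) only, by subadditivity of
γ and slow variation of β (`GrowthTriple.limsup_le_of_eventually_le`).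

The counting functions compare because the pole orders of f and f' differ by a factor at most 2. For
the proximity functions the tool is the Poisson–Jensen inequality: log⁺|f(w)| is at most the Poisson
integral of log⁺|f| over |z| = R plus the Green potential of the poles. At w = t exp(iθ) with t ≤ r,
both kernels are dominated, uniformly in t, by multiples of |sin(θ - φ)|^(-p), where φ is the
argument of the boundary point or pole. The exponent p = 1 fails to be integrable; p = 1 -
1/log(4/(1 - r)) costs only a bounded factor and has integral O(log(4/(1 - r))). This is the origin
of the logarithmic factor, and `exists_majorant` packages the result: one majorant in θ, valid along
almost every whole radius. A pole at 0 needs separate treatment.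

To bound f by f', the majorant for f' controls |f'| on almost every radius, and f is recovered by
integrating f' along it. To bound f' by f, the poles are removed by a finite Blaschke product B.
Harnack's inequality and Cauchy's estimate control (Bf)' and B', and B f' = (Bf)' - B' f yields a
pointwise bound for log⁺|f'| by the Poisson–Jensen expression of f (`posLog_norm_deriv_le`). -/

/-! ### Growth functions and comparison of upper limits. -/

/-- Functions of the class `L` are monotone on the whole line. -/
theorem ClassL.monotone {α : ℝ → ℝ} (h : ClassL α) : Monotone α := by
  obtain ⟨x₀, hc, hm⟩ := h.exists_const_increasing
  intro x y hxy
  rcases le_total y x₀ with hy | hy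
  · rw [hc x (hxy.trans hy), hc y hy]
  · rcases le_total x x₀ with hx | hx
    · rw [hc x hx]; exact hm Set.self_mem_Ici hy hy
    · exact hm hx hy hxy

/-- Functions of the class `L₁` are subadditive on the whole line up to a constant. -/
theorem ClassL1.exists_add_le {α : ℝ → ℝ} (h : ClassL1 α) :
    ∃ c : ℝ, ∀ a b, α (a + b) ≤ α a + α b + c := by
  obtain ⟨c, -, R₀, hR⟩ := h.almost_subadditive
  have hmax : ∀ a, α (max a R₀) ≤ α a + α R₀ := fun a => by
    rcases max_choice a R₀ with ha | ha <;> rw [ha]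
    · linarith [h.nonneg R₀]
    · linarith [h.nonneg a]
  refine ⟨2 * α R₀ + c, fun a b => ?_⟩
  have h1 : α (a + b) ≤ α (max a R₀ + max b R₀) :=
    h.monotone (add_le_add (le_max_left _ _) (le_max_left _ _))
  linarith [hR _ _ (le_max_right a R₀) (le_max_right b R₀), hmax a, hmax b]

theorem tendsto_one_div_one_sub :
    Tendsto (fun r : ℝ => 1 / (1 - r)) (𝓝[<] 1) atTop := by
  simp only [one_div]
  refine tendsto_inv_nhdsGT_zero.comp ?_
  refine tendsto_nhdsWithin_of_tendsto_nhds_of_eventually_within _ ?_ ?_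
  · have : Tendsto (fun r : ℝ => 1 - r) (𝓝 1) (𝓝 (1 - 1)) := tendsto_const_nhds.sub tendsto_id
    simpa using this.mono_left nhdsWithin_le_nhds
  · filter_upwards [self_mem_nhdsWithin] with r hr
    simpa using hr

theorem tendsto_midpoint_one :
    Tendsto (fun r : ℝ => (1 + r) / 2) (𝓝[<] 1) (𝓝[<] 1) := by
  refine tendsto_nhdsWithin_of_tendsto_nhds_of_eventually_within _ ?_ ?_
  · have : Tendsto (fun r : ℝ => (1 + r) / 2) (𝓝 1) (𝓝 ((1 + 1) / 2)) :=
      (tendsto_const_nhds.add tendsto_id).div_const 2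
    simpa using this.mono_left nhdsWithin_le_nhds
  · filter_upwards [self_mem_nhdsWithin] with r hr
    have : r < 1 := hr
    simp only [Set.mem_Iio]; linarith

namespace GrowthTriple

variable {α β γ : ℝ → ℝ}

theorem tendsto_denominator (h : GrowthTriple α β γ) :
    Tendsto (fun x => β (Real.log (γ x))) atTop atTop :=
  h.middle.tendsto_atTop.comp (Real.tendsto_log_atTop.comp h.right.tendsto_atTop)

/-- The denominator of the order grows by a factor `1 + o(1)` when its argument is doubled. -/
theorem eventually_denominator_two_mul_le (h : GrowthTriple α β γ) {ε : ℝ} (hε : 0 < ε) :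
    ∀ᶠ x in atTop, β (Real.log (γ (2 * x))) ≤ (1 + ε) * β (Real.log (γ x)) := by
  have hs := h.middle.shift (fun _ => Real.log 2) (isBigO_const_const _ one_ne_zero _)
  have h1 := (hs.isLittleO.def hε)
  have hl : Tendsto (fun x => Real.log (γ x)) atTop atTop :=
    Real.tendsto_log_atTop.comp h.right.tendsto_atTop
  obtain ⟨R₀, hR⟩ := h.right.subadditive
  filter_upwards [hl.eventually h1, eventually_ge_atTop R₀,
    h.right.tendsto_atTop.eventually_gt_atTop 0, eventually_ge_atTop 0] with x hx hxR hpos hx0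
  -- Subadditivity turns doubling of x into a shift of log γ(x) by at most log 2, which β absorbs.
  have h2 : γ (2 * x) ≤ 2 * γ x := by
    have := hR x x hxR hxR
    rw [two_mul, two_mul]; exact this
  have h3 : 0 < γ (2 * x) := hpos.trans_le (h.right.monotone (by linarith))
  have h4 : Real.log (γ (2 * x)) ≤ Real.log (γ x) + Real.log 2 := by
    rw [← Real.log_mul hpos.ne' two_ne_zero]
    exact Real.log_le_log h3 (by linarith)
  have h5 := h.middle.monotone h4
  have h6 := h.middle.nonneg (Real.log (γ x))
  simp only [Pi.sub_apply, Real.norm_eq_abs] at hx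
  rw [abs_of_nonneg h6] at hx
  linarith [le_abs_self (β (Real.log (γ x) + Real.log 2) - β (Real.log (γ x)))]

/-- A bound for the numerator with a negligible error term transfers to the upper limits. -/
theorem limsup_le_of_eventually_le (h : GrowthTriple α β γ) {A₁ A₂ : ℝ → ℝ} {p : ℕ} (hp : 2 ≤ p)
    {C : ℝ} (hA : ∀ᶠ r in 𝓝[<] (1 : ℝ),
      A₁ r ≤ A₂ ((1 + r) / 2) + (Real.log^[p] (1 / (1 - r)) + C)) :
    limsup (fun r : ℝ => ((α (A₁ r) / β (Real.log (γ (1 / (1 - r)))) : ℝ) : EReal)) (𝓝[<] 1) ≤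
      limsup (fun r : ℝ => ((α (A₂ r) / β (Real.log (γ (1 / (1 - r)))) : ℝ) : EReal)) (𝓝[<] 1) := by
  obtain ⟨c, hc⟩ := h.left.exists_add_le
  set D : ℝ → ℝ := fun x => β (Real.log (γ x)) with hD
  have hDtop : Tendsto (fun r : ℝ => D (1 / (1 - r))) (𝓝[<] 1) atTop :=
    h.tendsto_denominator.comp tendsto_one_div_one_sub
  refine le_of_forall_gt fun b hb => ?_
  obtain ⟨b₁, hb₁, hb₁'⟩ := EReal.lt_iff_exists_real_btwn.1 hb
  obtain ⟨b₂, hb₂, hb₂'⟩ := EReal.lt_iff_exists_real_btwn.1 hb₁'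
  have hb₁₂ : b₁ < b₂ := by exact_mod_cast hb₂
  have hev := eventually_lt_of_limsup_lt hb₁
  have hb₁pos : 0 ≤ b₁ := by
    obtain ⟨r, hr⟩ := hev.exists
    have h0 : (0 : ℝ) ≤ α (A₂ r) / D (1 / (1 - r)) :=
      div_nonneg (h.left.nonneg _) (h.middle.nonneg _)
    have h1 : α (A₂ r) / D (1 / (1 - r)) < b₁ := by exact_mod_cast hr
    linarith
  refine lt_of_le_of_lt (limsup_le_of_le (a := (b₂ : EReal)) (by isBoundedDefault) ?_) hb₂'
  -- The loss b₁ε comes from doubling the argument of the denominator; one further ε pays for the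
  -- iterated logarithm and one for the constants α C + 2c.
  obtain ⟨ε, hε, hεb⟩ : ∃ ε > 0, b₁ * (1 + ε) + 2 * ε ≤ b₂ := by
    refine ⟨(b₂ - b₁) / (b₁ + 2), div_pos (by linarith) (by linarith), le_of_eq ?_⟩
    field_simp
    ring
  have hiter := (h.iterated_log p hp).def hε
  filter_upwards [hA, tendsto_midpoint_one.eventually hev,
    tendsto_one_div_one_sub.eventually (h.eventually_denominator_two_mul_le hε),
    tendsto_one_div_one_sub.eventually hiter,
    hDtop.eventually_gt_atTop 0, hDtop.eventually_ge_atTop ((α C + 2 * c) / ε),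
    (tendsto_midpoint_one.eventually (hDtop.eventually_gt_atTop 0)), self_mem_nhdsWithin]
    with r h1 h2 h3 h4 h5 h6 h7 hr1
  have hr1 : r < 1 := hr1
  have h2' : α (A₂ ((1 + r) / 2)) / D (1 / (1 - (1 + r) / 2)) < b₁ := by exact_mod_cast h2
  rw [div_lt_iff₀ h7] at h2'
  have harg : 1 / (1 - (1 + r) / 2) = 2 * (1 / (1 - r)) := by
    have : 1 - r ≠ 0 := by linarith
    have : 2 - (1 + r) ≠ 0 := by intro h; apply this; linarith
    field_simp
    ring
  rw [harg] at h2'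
  have h8 := mul_le_mul_of_nonneg_left h3 hb₁pos
  simp only [Real.norm_eq_abs, abs_of_nonneg (h.left.nonneg _), abs_of_nonneg (h.middle.nonneg _)]
    at h4
  rw [div_le_iff₀ hε] at h6
  have h9 := h.left.monotone h1
  have h10 := hc (A₂ ((1 + r) / 2)) (Real.log^[p] (1 / (1 - r)) + C)
  have h11 := hc (Real.log^[p] (1 / (1 - r))) C
  rw [EReal.coe_le_coe_iff, div_le_iff₀ h5]
  have h12 := mul_le_mul_of_nonneg_right hεb h5.le
  simp only [hD] at *
  nlinarith

end GrowthTriple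

/-! ### Comparison of characteristics up to a logarithmic factor. -/

theorem log_log_four_mul_le {x : ℝ} (hx : 4 ≤ x) :
    Real.log (Real.log (4 * x)) ≤ Real.log (Real.log x) + Real.log 2 := by
  have h1 : 0 < Real.log x := Real.log_pos (by linarith)
  rw [← Real.log_mul h1.ne' two_ne_zero]
  have h2 : Real.log (4 * x) = Real.log 4 + Real.log x := Real.log_mul (by norm_num) (by linarith)
  have h3 : Real.log 4 ≤ Real.log x := Real.log_le_log (by norm_num) hx
  have h4 : 0 < Real.log 4 := Real.log_pos (by norm_num)
  exact Real.log_le_log (by linarith) (by linarith)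

/-- Comparison of two characteristics up to a logarithmic factor. -/
def LogComparable (T₁ T₂ : ℝ → ℝ) : Prop :=
  ∃ C : ℝ, 1 ≤ C ∧ ∀ᶠ r in 𝓝[<] (1 : ℝ),
    |T₁ r| ≤ C * Real.log (4 / (1 - r)) * (|T₂ ((1 + r) / 2)| + C)

/-- The logarithm turns the product into a sum, with log log(4/(1 - r)) ≤ log log(1/(1 - r)) + log 2
near 1. -/
theorem LogComparable.posLog_le {T₁ T₂ : ℝ → ℝ} (h : LogComparable T₁ T₂) :
    ∃ C : ℝ, 0 ≤ C ∧ ∀ᶠ r in 𝓝[<] (1 : ℝ), Real.posLog (T₁ r) ≤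
      Real.posLog (T₂ ((1 + r) / 2)) + (Real.log^[2] (1 / (1 - r)) + C) := by
  obtain ⟨C, hC, h⟩ := h
  refine ⟨Real.posLog C + Real.log 2 + (Real.log 2 + Real.posLog C), ?_, ?_⟩
  · have := Real.posLog_nonneg (x := C)
    have := Real.log_nonneg one_le_two
    linarith
  filter_upwards [h, tendsto_one_div_one_sub.eventually_ge_atTop 4,
    tendsto_one_div_one_sub.eventually_ge_atTop (Real.exp 1)] with r h1 h2 h3
  have h4 : 4 / (1 - r) = 4 * (1 / (1 - r)) := by ring
  have h5 := log_log_four_mul_le h2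
  rw [h4] at h1
  have hL : 1 ≤ Real.log (4 * (1 / (1 - r))) := by
    rw [Real.le_log_iff_exp_le (by linarith)]; linarith
  have h6 : Real.posLog (T₁ r) ≤ Real.posLog C + Real.posLog (Real.log (4 * (1 / (1 - r)))) +
      (Real.log 2 + Real.posLog (T₂ ((1 + r) / 2)) + Real.posLog C) := by
    -- The characteristic may be negative because of a pole at 0, while monotonicity of
    -- `Real.posLog` requires non-negative arguments.
    rw [← Real.posLog_abs (T₁ r)]
    refine (Real.posLog_le_posLog (abs_nonneg _) h1).trans ?_
    refine Real.posLog_mul.trans (add_le_add Real.posLog_mul ?_)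
    refine Real.posLog_add.trans ?_
    rw [Real.posLog_abs]
  rw [Real.posLog_eq_log (x := Real.log (4 * (1 / (1 - r))))
    (by rwa [abs_of_nonneg (by linarith)])] at h6
  simp only [Function.iterate_succ, Function.iterate_zero, Function.comp, id]
  linarith

theorem LogComparable.posLog_posLog_le {T₁ T₂ : ℝ → ℝ} (h : LogComparable T₁ T₂) :
    ∃ C : ℝ, ∀ᶠ r in 𝓝[<] (1 : ℝ), Real.posLog (Real.posLog (T₁ r)) ≤
      Real.posLog (Real.posLog (T₂ ((1 + r) / 2))) + (Real.log^[3] (1 / (1 - r)) + C) := by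
  obtain ⟨C, hC, h⟩ := h.posLog_le
  refine ⟨Real.log 2 + Real.log 2 + Real.posLog C, ?_⟩
  have hll : Tendsto (fun r : ℝ => Real.log (Real.log (1 / (1 - r)))) (𝓝[<] 1) atTop :=
    Real.tendsto_log_atTop.comp (Real.tendsto_log_atTop.comp tendsto_one_div_one_sub)
  filter_upwards [h, hll.eventually_ge_atTop 1] with r h1 h2
  simp only [Function.iterate_succ, Function.iterate_zero, Function.comp, id] at h1 ⊢
  rw [← Real.posLog_eq_log (x := Real.log (Real.log (1 / (1 - r))))
    (by rwa [abs_of_nonneg (by linarith)])]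
  refine (Real.posLog_le_posLog Real.posLog_nonneg h1).trans ?_
  linarith [Real.posLog_add (x := Real.posLog (T₂ ((1 + r) / 2)))
      (y := Real.log (Real.log (1 / (1 - r))) + C),
    Real.posLog_add (x := Real.log (Real.log (1 / (1 - r)))) (y := C)]

theorem GrowthTriple.orders_le {α β γ : ℝ → ℝ} (h : GrowthTriple α β γ) {f g : ℂ → ℂ}
    (hfg : LogComparable (nevanlinnaT f) (nevanlinnaT g)) :
    growthOrder α β γ f ≤ growthOrder α β γ g ∧
      growthOrderLog α β γ f ≤ growthOrderLog α β γ g := by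
  obtain ⟨C, -, hC⟩ := hfg.posLog_le
  obtain ⟨C', hC'⟩ := hfg.posLog_posLog_le
  exact ⟨h.limsup_le_of_eventually_le le_rfl hC, h.limsup_le_of_eventually_le (by norm_num) hC'⟩

open Metric MeromorphicOn MeasureTheory
open scoped ENNReal

/-! ### Pole orders and counting functions. -/

/-- The multiplicity of `b` as a pole of `f`, zero if `b` is not a pole. -/
noncomputable def poleOrder (f : ℂ → ℂ) (b : ℂ) : ℕ := (-(meromorphicOrderAt f b).untop₀).toNat

theorem negPart_divisor_apply {f : ℂ → ℂ} {U : Set ℂ} (hf : MeromorphicOn f U) {b : ℂ}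
    (hb : b ∈ U) : (divisor f U)⁻ b = (poleOrder f b : ℤ) := by
  rw [Function.locallyFinsuppWithin.negPart_apply, divisor_apply hf hb, poleOrder, negPart_def]
  exact (Int.toNat_eq_max _).symm

theorem poleOrder_eq_zero_of_nonneg {f : ℂ → ℂ} {b : ℂ} (h : 0 ≤ meromorphicOrderAt f b) :
    poleOrder f b = 0 := by
  unfold poleOrder
  induction h' : meromorphicOrderAt f b with
  | top => simp
  | coe n =>
    rw [h'] at h
    have : 0 ≤ n := by exact_mod_cast h
    simp [this]

theorem AnalyticAt.poleOrder_eq_zero {f : ℂ → ℂ} {b : ℂ} (hf : AnalyticAt ℂ f b) :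
    poleOrder f b = 0 :=
  poleOrder_eq_zero_of_nonneg hf.meromorphicOrderAt_nonneg

theorem poleOrder_le_poleOrder_deriv {f : ℂ → ℂ} (b : ℂ) :
    poleOrder f b ≤ poleOrder (deriv f) b := by
  unfold poleOrder
  induction h : meromorphicOrderAt f b with
  | top => simp
  | coe n =>
    rcases le_or_gt 0 n with hn | hn
    · simp [hn]
    · rw [meromorphicOrderAt_deriv_eq_sub_one (n := n) (by exact_mod_cast hn.ne) h]
      simp only [WithTop.untop₀_coe]
      omega

/-- A pole of order n ≥ 1 becomes one of order n + 1 ≤ 2n. Where the order is non-negative, f agrees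
off b with a function analytic at b, so its derivative acquires no pole. -/
theorem poleOrder_deriv_le {f : ℂ → ℂ} {b : ℂ} (hf : MeromorphicAt f b) :
    poleOrder (deriv f) b ≤ 2 * poleOrder f b := by
  rcases le_or_gt 0 (meromorphicOrderAt f b) with h | h
  · suffices 0 ≤ meromorphicOrderAt (deriv f) b by
      rw [poleOrder_eq_zero_of_nonneg this]
      exact Nat.zero_le _
    have heq : f =ᶠ[𝓝[≠] b] toMeromorphicNFAt f b := hf.eq_nhdsNE_toMeromorphicNFAt
    have han : AnalyticAt ℂ (toMeromorphicNFAt f b) b := by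
      rw [← meromorphicNFAt_toMeromorphicNFAt.meromorphicOrderAt_nonneg_iff_analyticAt,
        ← meromorphicOrderAt_congr heq]
      exact h
    rw [meromorphicOrderAt_congr heq.nhdsNE_deriv]
    exact han.deriv.meromorphicOrderAt_nonneg
  · unfold poleOrder
    induction h' : meromorphicOrderAt f b with
    | top => simp [h'] at h
    | coe n =>
      rw [h'] at h
      have hn : n < 0 := by exact_mod_cast h
      rw [meromorphicOrderAt_deriv_eq_sub_one (n := n) (by exact_mod_cast hn.ne) h']
      simp only [WithTop.untop₀_coe]
      omega

theorem exists_finset_poles {f : ℂ → ℂ} {R : ℝ} (hf : MeromorphicOn f (closedBall 0 R)) :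
    ∃ S : Finset ℂ, ∀ b, b ∈ S ↔ ‖b‖ ≤ R ∧ poleOrder f b ≠ 0 := by
  have hfin : ((divisor f (closedBall 0 R))⁻).support.Finite :=
    ((divisor f (closedBall 0 R))⁻).finiteSupport (isCompact_closedBall 0 R)
  refine ⟨hfin.toFinset, fun b => ?_⟩
  rw [Set.Finite.mem_toFinset, Function.mem_support]
  by_cases hb : b ∈ closedBall (0 : ℂ) R
  · rw [negPart_divisor_apply hf hb]
    simp at hb
    simp [hb]
  · rw [Function.locallyFinsuppWithin.apply_eq_zero_of_notMem _ hb]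
    simp at hb
    simp [hb]

/-- With log⁺ in place of log, points outside the disc contribute nothing. A single finite set can
therefore be used for two radii and two functions at once. -/
theorem poleCounting_eq_sum {f : ℂ → ℂ} {r : ℝ} (hr : 0 < r)
    (hf : MeromorphicOn f (closedBall 0 r)) {S : Finset ℂ}
    (hS : ∀ b, ‖b‖ ≤ r → poleOrder f b ≠ 0 → b ∈ S) :
    poleCounting f r = ∑ b ∈ S, poleOrder f b * Real.posLog (r * ‖b‖⁻¹) +
      poleOrder f 0 * Real.log r := by
  have h0 : (0 : ℂ) ∈ closedBall (0 : ℂ) r := by simp [hr.le]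
  rw [poleCounting, abs_of_pos hr, negPart_divisor_apply hf h0]
  congr 1
  have hterm : ∀ u : ℂ, (((divisor f (closedBall 0 r))⁻ u : ℤ) : ℝ) * Real.log (r * ‖u‖⁻¹) =
      poleOrder f u * Real.posLog (r * ‖u‖⁻¹) := fun u => by
    by_cases hu : u ∈ closedBall (0 : ℂ) r
    · rw [negPart_divisor_apply hf hu, Int.cast_natCast]
      rcases eq_or_ne u 0 with rfl | hu0
      · simp
      · rw [Real.posLog_eq_log]
        have hpos : 0 < ‖u‖ := norm_pos_iff.2 hu0
        rw [← div_eq_mul_inv, abs_of_pos (by positivity), one_le_div hpos]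
        simpa using hu
    · rw [Function.locallyFinsuppWithin.apply_eq_zero_of_notMem _ hu]
      have hu' : r < ‖u‖ := by simpa using hu
      rw [(Real.posLog_eq_zero_iff _).2]
      · simp
      · rw [← div_eq_mul_inv, abs_of_pos (div_pos hr (hr.trans hu')),
          div_le_one (hr.trans hu')]
        exact hu'.le
  simp_rw [hterm]
  refine finsum_eq_sum_of_support_subset _ fun u hu => ?_
  have hu' : poleOrder f u ≠ 0 ∧ Real.posLog (r * ‖u‖⁻¹) ≠ 0 := by simpa using hu
  refine hS u ?_ hu'.1
  by_contra hlt
  refine hu'.2 ((Real.posLog_eq_zero_iff _).2 ?_)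
  push Not at hlt
  rw [← div_eq_mul_inv, abs_of_pos (div_pos hr (hr.trans hlt)), div_le_one (hr.trans hlt)]
  exact hlt.le

theorem log_two_mul_nonneg_of_half_le {R : ℝ} (hR : 1 / 2 ≤ R) : 0 ≤ Real.log R + Real.log 2 := by
  rw [← Real.log_mul (by linarith) two_ne_zero]
  exact Real.log_nonneg (by linarith)

/-- Comparison of the counting functions of two functions whose poles have comparable orders. -/
theorem poleCounting_le {f g : ℂ → ℂ} {r R : ℝ} {k : ℕ} (hr : 0 < r) (hrR : r ≤ R)
    (hR : 1 / 2 ≤ R) (hr1 : r ≤ 1) (hf : MeromorphicOn f (closedBall 0 r))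
    (hg : MeromorphicOn g (closedBall 0 R))
    (hfg : ∀ b ∈ closedBall (0 : ℂ) r, poleOrder f b ≤ k * poleOrder g b) :
    poleCounting f r ≤ k * (poleCounting g R + poleOrder g 0 * Real.log 2) := by
  obtain ⟨S, hS⟩ := exists_finset_poles hg
  have hSf : ∀ b, ‖b‖ ≤ r → poleOrder f b ≠ 0 → b ∈ S := fun b hb h => by
    refine (hS b).2 ⟨hb.trans hrR, fun h0 => h ?_⟩
    have := hfg b (by simpa using hb)
    simpa [h0] using this
  rw [poleCounting_eq_sum hr hf hSf,
    poleCounting_eq_sum (hr.trans_le hrR) hg (fun b hb h => (hS b).2 ⟨hb, h⟩)]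
  have h1 : (poleOrder f 0 : ℝ) * Real.log r ≤ 0 :=
    mul_nonpos_of_nonneg_of_nonpos (by positivity) (Real.log_nonpos hr.le hr1)
  have h2 : ∑ b ∈ S, (poleOrder f b : ℝ) * Real.posLog (r * ‖b‖⁻¹) ≤
      k * ∑ b ∈ S, (poleOrder g b : ℝ) * Real.posLog (R * ‖b‖⁻¹) := by
    rw [Finset.mul_sum]
    refine Finset.sum_le_sum fun b hb => ?_
    have hmono : Real.posLog (r * ‖b‖⁻¹) ≤ Real.posLog (R * ‖b‖⁻¹) :=
      Real.posLog_le_posLog (by positivity) (by gcongr)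
    by_cases hbr : ‖b‖ ≤ r
    · have := hfg b (by simpa using hbr)
      have hc : (poleOrder f b : ℝ) ≤ k * poleOrder g b := by exact_mod_cast this
      rw [← mul_assoc]
      exact mul_le_mul hc hmono Real.posLog_nonneg (by positivity)
    · push Not at hbr
      rw [(Real.posLog_eq_zero_iff (r * ‖b‖⁻¹)).2]
      · have := Real.posLog_nonneg (x := R * ‖b‖⁻¹)
        rw [mul_zero]; positivity
      · rw [← div_eq_mul_inv, abs_of_pos (div_pos hr (hr.trans hbr)), div_le_one (hr.trans hbr)]
        exact hbr.le
  have h3 : 0 ≤ (k : ℝ) * (poleOrder g 0 * (Real.log R + Real.log 2)) := by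
    have := log_two_mul_nonneg_of_half_le hR
    positivity
  linarith

theorem le_poleCounting {f : ℂ → ℂ} {r : ℝ} (hr : 0 < r)
    (hf : MeromorphicOn f (closedBall 0 r)) : poleOrder f 0 * Real.log r ≤ poleCounting f r := by
  obtain ⟨S, hS⟩ := exists_finset_poles hf
  rw [poleCounting_eq_sum hr hf (fun b hb h => (hS b).2 ⟨hb, h⟩)]
  have : 0 ≤ ∑ b ∈ S, (poleOrder f b : ℝ) * Real.posLog (r * ‖b‖⁻¹) :=
    Finset.sum_nonneg fun b _ => mul_nonneg (by positivity) Real.posLog_nonneg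
  linarith

theorem proximity_top_nonneg (f : ℂ → ℂ) (r : ℝ) : 0 ≤ ValueDistribution.proximity f ⊤ r := by
  rw [ValueDistribution.proximity_top]
  exact Real.circleAverage_nonneg_of_nonneg fun x _ => Real.posLog_nonneg

/-- Only the term n₀ log r can be negative, and it tends to 0 as r → 1. -/
theorem eventually_neg_one_le_nevanlinnaT {f : ℂ → ℂ} (hf : MeromorphicOn f (ball 0 1)) :
    ∀ᶠ r in 𝓝[<] (1 : ℝ), -1 ≤ nevanlinnaT f r := by
  have h1 : Tendsto (fun r : ℝ => poleOrder f 0 * Real.log r) (𝓝[<] 1) (𝓝 0) := by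
    have : Tendsto (fun r : ℝ => poleOrder f 0 * Real.log r) (𝓝 1)
        (𝓝 (poleOrder f 0 * Real.log 1)) :=
      tendsto_const_nhds.mul (Real.continuousAt_log one_ne_zero)
    simpa using this.mono_left nhdsWithin_le_nhds
  filter_upwards [h1.eventually_const_lt (show (-1 : ℝ) < 0 by norm_num), self_mem_nhdsWithin,
    mem_nhdsWithin_of_mem_nhds (Ioi_mem_nhds (show (0 : ℝ) < 1 by norm_num))] with r h2 h3 h4
  have := le_poleCounting h4 (hf.mono_set (closedBall_subset_ball h3))
  have := proximity_top_nonneg f r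
  unfold nevanlinnaT
  linarith

/-! ### The Poisson–Jensen formula and inequality. -/

theorem continuousOn_poissonKernel_sphere {R : ℝ} {w : ℂ} (hw : w ∈ ball (0 : ℂ) R) :
    ContinuousOn (poissonKernel 0 w) (sphere 0 |R|) := by
  rw [poissonKernel_eq_re_herglotzRieszKernel]
  exact Complex.continuous_re.comp_continuousOn (continuousOn_herglotzRieszKernel_sphere hw)

theorem CircleIntegrable.poissonKernel_mul {R : ℝ} {w : ℂ} (hw : w ∈ ball (0 : ℂ) R) {F : ℂ → ℝ}
    (hF : CircleIntegrable F 0 R) : CircleIntegrable (fun z => poissonKernel 0 w z * F z) 0 R := by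
  refine IntervalIntegrable.continuousOn_mul hF ?_
  refine (continuousOn_poissonKernel_sphere hw).comp (continuous_circleMap 0 R).continuousOn ?_
  intro θ _
  simp

theorem poissonKernel_nonneg {R : ℝ} {w z : ℂ} (hw : w ∈ ball (0 : ℂ) R)
    (hz : z ∈ sphere (0 : ℂ) R) :
    0 ≤ poissonKernel 0 w z := by
  have h1 : ‖w‖ < R := by simpa using hw
  have h2 : ‖z‖ = R := by simpa using hz
  rw [poissonKernel_def]
  simp only [sub_zero, h2]
  have : ‖w‖ ^ 2 ≤ R ^ 2 := by gcongr
  exact div_nonneg (by linarith) (by positivity)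

theorem circleAverage_poissonKernel_mul_log_norm_sub {R : ℝ} {w v : ℂ} (hw : w ∈ ball (0 : ℂ) R)
    (hv : v ∈ sphere (0 : ℂ) R) :
    Real.circleAverage (fun z => poissonKernel 0 w z * Real.log ‖z - v‖) 0 R =
      Real.log ‖w - v‖ := by
  rw [← circleAverage_re_herglotzRieszKernel_mul_log hv hw, poissonKernel_eq_re_herglotzRieszKernel]
  rfl

/-- The Poisson–Jensen formula. -/
theorem circleAverage_poissonKernel_mul_log_norm {f : ℂ → ℂ} {R : ℝ} (hR : 0 < R)
    (hf : MeromorphicOn f (closedBall 0 R))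
    (hf' : ∀ u : closedBall (0 : ℂ) R, meromorphicOrderAt f u ≠ ⊤) {w : ℂ}
    (hw : w ∈ ball (0 : ℂ) R) (hwf : meromorphicOrderAt f w = 0) :
    Real.circleAverage (fun z => poissonKernel 0 w z * Real.log ‖f z‖) 0 R =
      ∑ᶠ u, divisor f (ball 0 R) u * Real.log ‖Complex.canonicalFactor R u w‖ +
        Real.log ‖meromorphicTrailingCoeffAt f w‖ := by
  obtain ⟨h, D⟩ := hf.exists_ecanonicalDecomp hf'
  have hfin : (divisor f (sphere (0 : ℂ) R)).support.Finite := divisor_sphere_support_finite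
  have hsum : ∀ z, ∑ᶠ v, (divisor f (sphere 0 R) v : ℝ) * Real.log ‖z - v‖ =
      ∑ v ∈ hfin.toFinset, (divisor f (sphere 0 R) v : ℝ) * Real.log ‖z - v‖ := fun z =>
    finsum_eq_sum_of_support_subset _ fun v hv => by
      have := left_ne_zero_of_mul hv
      simpa using this
  have hlog := D.log_norm_eq (ball_subset_closedBall hw) hwf hR
  have hharm : Real.circleAverage (fun z => poissonKernel 0 w z * Real.log ‖h z‖) 0 R =
      Real.log ‖h w‖ :=
    InnerProductSpace.HarmonicOnNhd.circleAverage_poissonKernel_smul (f := fun z => Real.log ‖h z‖)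
      (fun z hz => (D.analyticOnNhd z hz).harmonicAt_log_norm (D.ne_zero z hz)) hw
  have hsub : sphere (0 : ℂ) |R| ⊆ closedBall 0 R := by
    rw [abs_of_pos hR]; exact sphere_subset_closedBall
  -- Off the finitely many zeros and poles on the circle and a further discrete set, f is the
  -- product of its canonical decomposition, whose canonical factors have modulus 1 there.
  have hcongr : (fun z => poissonKernel 0 w z * Real.log ‖f z‖)
      =ᶠ[codiscreteWithin (sphere 0 |R|)] fun z =>
        (∑ v ∈ hfin.toFinset, (divisor f (sphere 0 R) v : ℝ) *
          (poissonKernel 0 w z * Real.log ‖z - v‖)) + poissonKernel 0 w z * Real.log ‖h z‖ := by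
    filter_upwards [codiscreteWithin_mono hsub D.eventuallyEq, self_mem_codiscreteWithin _,
      codiscreteWithin_mono (Set.subset_univ _) hfin.compl_mem_codiscrete] with z h1 h2 h3
    have hz : z ∈ sphere (0 : ℂ) R := by rwa [abs_of_pos hR] at h2
    have hbfin : (divisor f (ball (0 : ℂ) R)).support.Finite := hf.divisor_ball_support_finite
    have e1 : (∏ᶠ u, Complex.canonicalFactor R u ^ (-divisor f (ball 0 R) u)) =
        ∏ u ∈ hbfin.toFinset, Complex.canonicalFactor R u ^ (-divisor f (ball 0 R) u) :=
      finprod_eq_prod_of_mulSupport_subset _ fun u hu => by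
        by_contra hc
        simp only [Set.Finite.coe_toFinset, Function.mem_support, not_not] at hc
        simp [hc] at hu
    have e2 : (∏ᶠ v, (fun z : ℂ => z - v) ^ (divisor f (sphere 0 R) v)) =
        ∏ v ∈ hfin.toFinset, (fun z : ℂ => z - v) ^ (divisor f (sphere 0 R) v) :=
      finprod_eq_prod_of_mulSupport_subset _ fun u hu => by
        by_contra hc
        simp only [Set.Finite.coe_toFinset, Function.mem_support, not_not] at hc
        simp [hc] at hu
    rw [h1, e1, e2]
    simp only [Pi.smul_apply', Pi.mul_apply, Finset.prod_apply, Pi.pow_apply, norm_smul, norm_mul,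
      norm_prod, norm_zpow]
    rw [Finset.prod_eq_one (s := hbfin.toFinset), one_mul, Real.log_mul, Real.log_prod]
    · simp_rw [Real.log_zpow, mul_add, Finset.mul_sum, mul_left_comm]
    · intro v hv
      refine zpow_ne_zero _ (norm_ne_zero_iff.2 (sub_ne_zero.2 ?_))
      rintro rfl
      exact h3 (by simpa using hv)
    · refine Finset.prod_ne_zero_iff.2 fun v hv => ?_
      refine zpow_ne_zero _ (norm_ne_zero_iff.2 (sub_ne_zero.2 ?_))
      rintro rfl
      exact h3 (by simpa using hv)
    · exact norm_ne_zero_iff.2 (D.ne_zero z (sphere_subset_closedBall hz))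
    · intro u hu
      rw [Complex.norm_canonicalFactor_eval_circle_eq_one _ hz, one_zpow]
      refine (divisor f (ball 0 R)).supportWithinDomain ?_
      simpa using hu
  have hint : ∀ v, CircleIntegrable (fun z => poissonKernel 0 w z * Real.log ‖z - v‖) 0 R :=
    fun v => CircleIntegrable.poissonKernel_mul hw
      (circleIntegrable_log_norm (f := fun z => z - v) (by intro z _; fun_prop))
  rw [Real.circleAverage_congr_codiscreteWithin hcongr hR.ne', Real.circleAverage_fun_add,
    Real.circleAverage_fun_sum, hharm, hlog, hsum]
  · simp_rw [← smul_eq_mul (a := ((divisor f (sphere 0 R) _ : ℤ) : ℝ)), Real.circleAverage_fun_smul]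
    have : ∀ v ∈ hfin.toFinset, (divisor f (sphere 0 R) v : ℝ) •
        Real.circleAverage (fun z => poissonKernel 0 w z * Real.log ‖z - v‖) 0 R =
        (divisor f (sphere 0 R) v : ℝ) • Real.log ‖w - v‖ := fun v hv => by
      rw [circleAverage_poissonKernel_mul_log_norm_sub hw]
      refine (divisor f (sphere 0 R)).supportWithinDomain ?_
      simpa using hv
    rw [Finset.sum_congr rfl this]
    simp only [smul_eq_mul]
    ring
  · exact fun v _ => IntervalIntegrable.const_mul (hint v) _
  · exact CircleIntegrable.fun_sum _ fun v _ => IntervalIntegrable.const_mul (hint v) _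
  · refine CircleIntegrable.poissonKernel_mul hw (circleIntegrable_log_norm ?_)
    exact (D.analyticOnNhd.mono hsub).meromorphicOn

/-- For |b|, |w| ≤ R the last product is non-negative, which is why the canonical factor has modulus
at least 1 and the Green function log|factor| is non-negative. -/
theorem normSq_sub_conj_mul {R : ℝ} (b w : ℂ) :
    ‖(R : ℂ) ^ 2 - (starRingEnd ℂ) b * w‖ ^ 2 =
      (R * ‖w - b‖) ^ 2 + (R ^ 2 - ‖w‖ ^ 2) * (R ^ 2 - ‖b‖ ^ 2) := by
  rw [mul_pow]
  simp only [← Complex.normSq_eq_norm_sq, Complex.normSq_apply, ← Complex.ofReal_pow,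
    Complex.sub_re, Complex.sub_im, Complex.mul_re, Complex.mul_im, Complex.conj_re,
    Complex.conj_im, Complex.ofReal_re, Complex.ofReal_im]
  ring

theorem one_le_norm_canonicalFactor {R : ℝ} {b w : ℂ} (hR : 0 < R) (hb : ‖b‖ ≤ R) (hw : ‖w‖ ≤ R)
    (hwb : w ≠ b) : 1 ≤ ‖Complex.canonicalFactor R b w‖ := by
  have hd : 0 < ‖w - b‖ := norm_pos_iff.2 (sub_ne_zero.2 hwb)
  rw [Complex.canonicalFactor_apply, norm_div, norm_mul, Complex.norm_real, Real.norm_eq_abs,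
    abs_of_pos hR, one_le_div (by positivity)]
  refine (pow_le_pow_iff_left₀ (by positivity) (norm_nonneg _) two_ne_zero).1 ?_
  rw [normSq_sub_conj_mul]
  have h1 : ‖b‖ ^ 2 ≤ R ^ 2 := by gcongr
  have h2 : ‖w‖ ^ 2 ≤ R ^ 2 := by gcongr
  nlinarith [mul_nonneg (sub_nonneg.2 h1) (sub_nonneg.2 h2)]

theorem log_norm_canonicalFactor_nonneg {R : ℝ} {b w : ℂ} (hR : 0 < R) (hb : ‖b‖ ≤ R)
    (hw : ‖w‖ ≤ R) : 0 ≤ Real.log ‖Complex.canonicalFactor R b w‖ := by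
  rcases eq_or_ne w b with rfl | h
  · simp
  · exact Real.log_nonneg (one_le_norm_canonicalFactor hR hb hw h)

/-- The Poisson integral of `log⁺ ‖f‖` over the circle `|z| = R`. -/
noncomputable def poissonPosLog (f : ℂ → ℂ) (R : ℝ) (w : ℂ) : ℝ :=
  Real.circleAverage (fun z => poissonKernel 0 w z * Real.posLog ‖f z‖) 0 R

theorem poissonPosLog_nonneg {f : ℂ → ℂ} {R : ℝ} {w : ℂ} (hw : w ∈ ball (0 : ℂ) R) :
    0 ≤ poissonPosLog f R w := by
  have hR : 0 < R := pos_of_mem_ball hw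
  refine Real.circleAverage_nonneg_of_nonneg fun z hz => ?_
  rw [abs_of_pos hR] at hz
  exact mul_nonneg (poissonKernel_nonneg hw hz) Real.posLog_nonneg

/-- In the Poisson–Jensen formula log|f| is replaced by log⁺|f| and the zeros, whose contribution is
non-positive, are dropped. -/
theorem log_norm_add_sum_le_poissonPosLog {f : ℂ → ℂ} {R : ℝ}
    (hf : MeromorphicOn f (closedBall 0 R)) {S : Finset ℂ}
    (hS : ∀ b, b ∈ S ↔ ‖b‖ ≤ R ∧ poleOrder f b ≠ 0) {w : ℂ} (hw : w ∈ ball (0 : ℂ) R)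
    (hwf : AnalyticAt ℂ f w) (hfw : f w ≠ 0) :
    Real.log ‖f w‖ ≤ poissonPosLog f R w +
      ∑ b ∈ S, poleOrder f b * Real.log ‖Complex.canonicalFactor R b w‖ := by
  have hR : 0 < R := pos_of_mem_ball hw
  have hwc : w ∈ closedBall (0 : ℂ) R := ball_subset_closedBall hw
  have hord : meromorphicOrderAt f w = 0 :=
    hwf.meromorphicNFAt.meromorphicOrderAt_eq_zero_iff.2 hfw
  -- The order is finite at w, hence at every point of the connected disc.
  have hf' : ∀ u : closedBall (0 : ℂ) R, meromorphicOrderAt f u ≠ ⊤ := by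
    rw [← hf.exists_meromorphicOrderAt_ne_top_iff_forall (isConnected_closedBall hR.le)]
    exact ⟨⟨w, hwc⟩, by simp [hord]⟩
  have hPJ := circleAverage_poissonKernel_mul_log_norm hR hf hf' hw hord
  rw [hwf.meromorphicTrailingCoeffAt_of_ne_zero hfw] at hPJ
  have hsub : sphere (0 : ℂ) |R| ⊆ closedBall 0 R := by
    rw [abs_of_pos hR]; exact sphere_subset_closedBall
  have hle : Real.circleAverage (fun z => poissonKernel 0 w z * Real.log ‖f z‖) 0 R ≤
      poissonPosLog f R w := by
    refine Real.circleAverage_mono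
      (CircleIntegrable.poissonKernel_mul hw (circleIntegrable_log_norm (hf.mono_set hsub)))
      (CircleIntegrable.poissonKernel_mul hw (circleIntegrable_posLog_norm (hf.mono_set hsub))) ?_
    intro z hz
    rw [abs_of_pos hR] at hz
    exact mul_le_mul_of_nonneg_left (le_max_right _ _) (poissonKernel_nonneg hw hz)
  have hbfin : (divisor f (ball (0 : ℂ) R)).support.Finite := hf.divisor_ball_support_finite
  have hfs : ∑ᶠ u, (divisor f (ball 0 R) u : ℝ) * Real.log ‖Complex.canonicalFactor R u w‖ =
      ∑ u ∈ hbfin.toFinset ∪ S,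
        (divisor f (ball 0 R) u : ℝ) * Real.log ‖Complex.canonicalFactor R u w‖ :=
    finsum_eq_sum_of_support_subset _ fun v hv => by
      have := left_ne_zero_of_mul hv
      simp only [Finset.coe_union, Set.Finite.coe_toFinset]
      exact Or.inl (by simpa using this)
  have hball : ∀ u ∈ hbfin.toFinset, u ∈ ball (0 : ℂ) R := fun u hu =>
    (divisor f (ball 0 R)).supportWithinDomain (by simpa using hu)
  have hSs : ∑ b ∈ S, poleOrder f b * Real.log ‖Complex.canonicalFactor R b w‖ =
      ∑ b ∈ hbfin.toFinset ∪ S, poleOrder f b * Real.log ‖Complex.canonicalFactor R b w‖ := by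
    refine Finset.sum_subset Finset.subset_union_right fun b hb hbS => ?_
    have hb' : b ∈ ball (0 : ℂ) R := by
      rcases Finset.mem_union.1 hb with h | h
      · exact hball b h
      · exact absurd h hbS
    have : poleOrder f b = 0 := by
      by_contra h
      exact hbS ((hS b).2 ⟨by simpa using (ball_subset_closedBall hb'), h⟩)
    simp [this]
  have hterm : -∑ᶠ u, (divisor f (ball 0 R) u : ℝ) * Real.log ‖Complex.canonicalFactor R u w‖ ≤
      ∑ b ∈ S, poleOrder f b * Real.log ‖Complex.canonicalFactor R b w‖ := by
    rw [hfs, hSs, ← Finset.sum_neg_distrib]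
    refine Finset.sum_le_sum fun u _ => ?_
    by_cases hu : u ∈ ball (0 : ℂ) R
    · rw [← neg_mul]
      refine mul_le_mul_of_nonneg_right ?_ (log_norm_canonicalFactor_nonneg hR
        (by simpa using ball_subset_closedBall hu) (by simpa using hwc))
      rw [divisor_apply (hf.mono_set ball_subset_closedBall) hu, poleOrder]
      exact_mod_cast Int.self_le_toNat _
    · rw [Function.locallyFinsuppWithin.apply_eq_zero_of_notMem _ hu]
      by_cases hu' : poleOrder f u = 0
      · simp [hu']
      · have huS : ‖u‖ ≤ R := by
          by_contra hc
          simp_all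
        have := log_norm_canonicalFactor_nonneg hR huS (by simpa using hwc : ‖w‖ ≤ R)
        simp only [Int.cast_zero, zero_mul, neg_zero]
        positivity
  linarith

theorem posLog_norm_le_poissonPosLog_add {f : ℂ → ℂ} {R : ℝ}
    (hf : MeromorphicOn f (closedBall 0 R)) {S : Finset ℂ}
    (hS : ∀ b, b ∈ S ↔ ‖b‖ ≤ R ∧ poleOrder f b ≠ 0) {w : ℂ} (hw : w ∈ ball (0 : ℂ) R)
    (hwf : AnalyticAt ℂ f w) :
    Real.posLog ‖f w‖ ≤ poissonPosLog f R w +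
      ∑ b ∈ S, poleOrder f b * Real.log ‖Complex.canonicalFactor R b w‖ := by
  have hR : 0 < R := pos_of_mem_ball hw
  have h0 : 0 ≤ poissonPosLog f R w +
      ∑ b ∈ S, poleOrder f b * Real.log ‖Complex.canonicalFactor R b w‖ := by
    refine add_nonneg (poissonPosLog_nonneg hw) (Finset.sum_nonneg fun b hb => ?_)
    exact mul_nonneg (by positivity) (log_norm_canonicalFactor_nonneg hR ((hS b).1 hb).1
      (by simpa using ball_subset_closedBall hw))
  rcases eq_or_ne (f w) 0 with h | h
  · simpa [h] using h0
  · exact max_le h0 (log_norm_add_sum_le_poissonPosLog hf hS hw hwf h)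

/-! ### Bounds for the Green and Poisson kernels with an exponent p < 1. -/

theorem log_one_add_le_rpow_div {y p : ℝ} (hy : 0 ≤ y) (hp : 0 < p) (hp1 : p ≤ 1) :
    Real.log (1 + y) ≤ y ^ p / p := by
  rw [le_div_iff₀ hp, mul_comm, ← Real.log_rpow (by linarith)]
  have h1 : (1 + y) ^ p ≤ 1 + y ^ p := by
    have := Real.rpow_add_le_add_rpow (p := p) zero_le_one hy hp.le hp1
    rwa [Real.one_rpow] at this
  have h2 : 0 < (1 + y) ^ p := Real.rpow_pos_of_pos (by linarith) _
  linarith [Real.log_le_sub_one_of_pos h2]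

theorem norm_canonicalFactor_le {R : ℝ} {b w : ℂ} (hR : 0 < R) (hb : ‖b‖ ≤ R) (hwb : w ≠ b) :
    ‖Complex.canonicalFactor R b w‖ ≤ 1 + 2 * (R - ‖b‖) / ‖w - b‖ := by
  have hd : 0 < ‖w - b‖ := norm_pos_iff.2 (sub_ne_zero.2 hwb)
  rw [Complex.canonicalFactor_apply, norm_div, norm_mul, Complex.norm_real, Real.norm_eq_abs,
    abs_of_pos hR, div_le_iff₀ (by positivity)]
  have h1 : (R : ℂ) ^ 2 - (starRingEnd ℂ) b * w =
      ((R ^ 2 - ‖b‖ ^ 2 : ℝ) : ℂ) - (starRingEnd ℂ) b * (w - b) := by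
    rw [mul_sub, ← Complex.normSq_eq_conj_mul_self, Complex.normSq_eq_norm_sq]
    push_cast
    ring
  have h2 : ‖b‖ ^ 2 ≤ R ^ 2 := by gcongr
  calc ‖(R : ℂ) ^ 2 - (starRingEnd ℂ) b * w‖
      ≤ (R ^ 2 - ‖b‖ ^ 2) + ‖b‖ * ‖w - b‖ := by
        rw [h1]
        refine (norm_sub_le _ _).trans (le_of_eq ?_)
        rw [Complex.norm_real, Real.norm_eq_abs, abs_of_nonneg (by linarith), norm_mul,
          RCLike.norm_conj]
    _ ≤ 2 * (R - ‖b‖) * R + R * ‖w - b‖ := by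
        nlinarith [mul_nonneg (sub_nonneg.2 hb) hd.le, norm_nonneg b, mul_nonneg (sub_nonneg.2 hb)
          (sub_nonneg.2 hb)]
    _ = (1 + 2 * (R - ‖b‖) / ‖w - b‖) * (R * ‖w - b‖) := by field_simp; ring

theorem rpow_neg_mul_rpow_sub_one {d p : ℝ} (hd : 0 < d) : d⁻¹ = d ^ (-p) * d ^ (p - 1) := by
  rw [← Real.rpow_add hd, ← Real.rpow_neg_one]
  congr 1
  ring

/-- The bound must be linear in s = R - ‖b‖, since s is what the counting function controls. If s ≥
κ, then log(1 + y) ≤ y^p/p applies, and s^p ≤ 3s because s^(p - 1) ≤ κ^(p - 1). If s < κ, then w is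
at distance d ≥ κ from b, and 2s/d is already small enough because d^(p - 1) ≤ 3. -/
theorem log_norm_canonicalFactor_le {R κ p : ℝ} {b w : ℂ} (hR : 0 < R) (hκ : 0 < κ)
    (hp : 1 / 2 ≤ p) (hp1 : p < 1) (hκp : κ ^ (p - 1) ≤ 3) (hb : ‖b‖ ≤ R) (hw : ‖w‖ ≤ R - 2 * κ)
    (hwb : w ≠ b) :
    Real.log ‖Complex.canonicalFactor R b w‖ ≤ 12 * (R - ‖b‖) * ‖w - b‖ ^ (-p) := by
  have hd : 0 < ‖w - b‖ := norm_pos_iff.2 (sub_ne_zero.2 hwb)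
  set d := ‖w - b‖
  set s := R - ‖b‖ with hs
  have hs0 : 0 ≤ s := sub_nonneg.2 hb
  have hdp : 0 < d ^ (-p) := Real.rpow_pos_of_pos hd _
  have hcf := one_le_norm_canonicalFactor hR hb (by linarith : ‖w‖ ≤ R) hwb
  have h1 : Real.log ‖Complex.canonicalFactor R b w‖ ≤ Real.log (1 + 2 * s / d) :=
    Real.log_le_log (by linarith) (norm_canonicalFactor_le hR hb hwb)
  refine h1.trans ?_
  rcases le_or_gt κ s with h | h
  · have hspos : 0 < s := hκ.trans_le h
    refine (log_one_add_le_rpow_div (p := p) (by positivity) (by linarith) hp1.le).trans ?_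
    have h2 : (2 * s / d) ^ p ≤ 6 * s * d ^ (-p) := by
      rw [Real.div_rpow (by positivity) hd.le, Real.mul_rpow (by norm_num) hs0, div_eq_mul_inv,
        ← Real.rpow_neg hd.le]
      have h3 : (2 : ℝ) ^ p ≤ 2 := by
        simpa using Real.rpow_le_rpow_of_exponent_le (x := 2) (by norm_num) hp1.le
      have h4 : s ^ p ≤ 3 * s := by
        have h5 : s ^ p = s ^ (p - 1) * s := by
          rw [← Real.rpow_add_one hspos.ne']; congr 1; ring
        rw [h5]
        have h6 : s ^ (p - 1) ≤ κ ^ (p - 1) :=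
          Real.rpow_le_rpow_of_nonpos hκ h (by linarith)
        exact mul_le_mul_of_nonneg_right (h6.trans hκp) hs0
      have : 2 ^ p * s ^ p ≤ 2 * (3 * s) := by gcongr
      nlinarith
    rw [div_le_iff₀ (by linarith)]
    nlinarith [mul_nonneg hs0 hdp.le]
  · have h2 : κ ≤ d := by
      have : ‖b‖ - ‖w‖ ≤ d := by
        have := norm_sub_norm_le b w
        rwa [norm_sub_rev] at this
      linarith
    have h3 : d ^ (p - 1) ≤ 3 := (Real.rpow_le_rpow_of_nonpos hκ h2 (by linarith)).trans hκp
    have h4 : Real.log (1 + 2 * s / d) ≤ 2 * s / d := by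
      have := Real.log_le_sub_one_of_pos (x := 1 + 2 * s / d) (by positivity)
      linarith
    have h5 : 2 * s / d = 2 * (s * d ^ (-p)) * d ^ (p - 1) := by
      rw [div_eq_mul_inv, rpow_neg_mul_rpow_sub_one (p := p) hd]; ring
    have h6 := mul_nonneg hs0 hdp.le
    nlinarith

theorem circleMap_eq_polar (t θ : ℝ) :
    circleMap 0 t θ = ⟨t * Real.cos θ, t * Real.sin θ⟩ := by
  apply Complex.ext
  · simp [circleMap_zero_re]
  · simp [circleMap_zero_im]

/-- The distance from `b` to the ray with argument `θ` is at least `‖b‖ |sin (θ - arg b)|`. -/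
theorem norm_mul_abs_sin_le (b : ℂ) (t θ : ℝ) :
    ‖b‖ * |Real.sin (θ - b.arg)| ≤ ‖circleMap 0 t θ - b‖ := by
  have h : ((circleMap 0 t θ - b) * circleMap 0 1 (-θ)).im = ‖b‖ * Real.sin (θ - b.arg) := by
    rw [circleMap_eq_polar, circleMap_eq_polar, Real.sin_sub]
    have h1 := Complex.norm_mul_cos_arg b
    have h2 := Complex.norm_mul_sin_arg b
    simp only [Complex.mul_im, Complex.sub_re, Complex.sub_im, Real.cos_neg, Real.sin_neg]
    rw [← h1, ← h2]
    ring
  have h2 : ‖(circleMap 0 t θ - b) * circleMap 0 1 (-θ)‖ = ‖circleMap 0 t θ - b‖ := by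
    simp
  rw [← h2, ← abs_of_nonneg (norm_nonneg b), ← abs_mul, ← h]
  exact Complex.abs_im_le_norm _

theorem norm_mul_abs_sin_le_circleMap (R t θ φ : ℝ) :
    |R| * |Real.sin (θ - φ)| ≤ ‖circleMap 0 R φ - circleMap 0 t θ‖ := by
  have h : ((circleMap 0 R φ - circleMap 0 t θ) * circleMap 0 1 (-θ)).im =
      -(R * Real.sin (θ - φ)) := by
    rw [circleMap_eq_polar, circleMap_eq_polar, circleMap_eq_polar, Real.sin_sub]
    simp only [Complex.mul_im, Complex.sub_re, Complex.sub_im, Real.cos_neg, Real.sin_neg]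
    ring
  have h2 : ‖(circleMap 0 R φ - circleMap 0 t θ) * circleMap 0 1 (-θ)‖ =
      ‖circleMap 0 R φ - circleMap 0 t θ‖ := by
    simp
  rw [← h2, ← abs_mul, ← abs_neg, ← h]
  exact Complex.abs_im_le_norm _

/-- The kernel is (R - t)(R + t)/d² ≤ 2/d. Splitting 1/d = d^(-p) d^(p - 1) costs a factor 3, and d
≥ |sin(θ - φ)|/2 costs a factor 2. The bound no longer depends on t. -/
theorem poissonKernel_circleMap_le {R κ p t θ φ : ℝ} (hR : 1 / 2 ≤ R) (hR1 : R ≤ 1) (hκ : 0 < κ)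
    (hp : 1 / 2 ≤ p) (hp1 : p < 1) (hκp : κ ^ (p - 1) ≤ 3) (ht : 0 ≤ t) (htR : t ≤ R - 2 * κ)
    (hsin : Real.sin (θ - φ) ≠ 0) :
    poissonKernel 0 (circleMap 0 t θ) (circleMap 0 R φ) ≤ 12 * |Real.sin (θ - φ)| ^ (-p) := by
  set d := ‖circleMap 0 R φ - circleMap 0 t θ‖ with hd
  have hRt : R - t ≤ d := by
    have := norm_sub_norm_le (circleMap 0 R φ) (circleMap 0 t θ)
    rw [norm_circleMap_zero, norm_circleMap_zero, abs_of_nonneg ht,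
      abs_of_nonneg (by linarith)] at this
    exact this
  have hsin0 : 0 < |Real.sin (θ - φ)| := abs_pos.2 hsin
  have hsd : R * |Real.sin (θ - φ)| ≤ d := by
    have := norm_mul_abs_sin_le_circleMap R t θ φ
    rwa [abs_of_nonneg (by linarith)] at this
  have hd0 : 0 < d := by linarith
  have h1 : poissonKernel 0 (circleMap 0 t θ) (circleMap 0 R φ) ≤ 2 * d⁻¹ := by
    rw [poissonKernel_def]
    simp only [sub_zero]
    rw [← hd, norm_circleMap_zero, norm_circleMap_zero, sq_abs, sq_abs, div_le_iff₀ (by positivity)]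
    have : 2 * d⁻¹ * d ^ 2 = 2 * d := by field_simp
    rw [this]
    nlinarith
  have h3 : d ^ (p - 1) ≤ 3 :=
    (Real.rpow_le_rpow_of_nonpos hκ (by linarith) (by linarith)).trans hκp
  have h4 : d ^ (-p) ≤ 2 * |Real.sin (θ - φ)| ^ (-p) := by
    have h5 : d ^ (-p) ≤ (R * |Real.sin (θ - φ)|) ^ (-p) :=
      Real.rpow_le_rpow_of_nonpos (by positivity) hsd (by linarith)
    rw [Real.mul_rpow (by linarith) hsin0.le] at h5
    have h6 : R ^ (-p) ≤ 2 := by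
      have h7 : R ^ (-p) ≤ (1 / 2 : ℝ) ^ (-p) :=
        Real.rpow_le_rpow_of_nonpos (by norm_num) hR (by linarith)
      have h8 : (1 / 2 : ℝ) ^ (-p) = 2 ^ p := by
        rw [Real.rpow_neg (by norm_num), ← Real.inv_rpow (by norm_num)]
        norm_num
      have h9 : (2 : ℝ) ^ p ≤ 2 := by
        simpa using Real.rpow_le_rpow_of_exponent_le (x := 2) (by norm_num) hp1.le
      linarith
    exact h5.trans (mul_le_mul_of_nonneg_right h6 (by positivity))
  rw [rpow_neg_mul_rpow_sub_one (p := p) hd0] at h1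
  have h5 : 0 < d ^ (-p) := Real.rpow_pos_of_pos hd0 _
  nlinarith

/-! ### Integrals of negative powers of the sine. -/

theorem ae_sin_sub_ne_zero (β : ℝ) : ∀ᵐ θ : ℝ, Real.sin (θ - β) ≠ 0 := by
  have hc : {θ : ℝ | Real.sin (θ - β) = 0}.Countable := by
    refine (Set.countable_range fun n : ℤ => n * Real.pi + β).mono fun θ hθ => ?_
    obtain ⟨n, hn⟩ := Real.sin_eq_zero_iff.1 hθ
    exact ⟨n, by simp only [hn]; ring⟩
  exact hc.ae_notMem _

/-- Jordan's inequality sin y ≥ 2y/π on [0, π/2], applied at x or at π - x. -/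
theorem abs_sin_rpow_le {p x : ℝ} (hp : 0 ≤ p) (hp1 : p ≤ 1) (hx : 0 < x) (hxπ : x < Real.pi) :
    |Real.sin x| ^ (-p) ≤ 2 * (x ^ (-p) + (Real.pi - x) ^ (-p)) := by
  have key : ∀ y, 0 < y → y ≤ Real.pi / 2 → |Real.sin y| ^ (-p) ≤ 2 * y ^ (-p) := by
    intro y hy hy'
    have h1 : 2 / Real.pi * y ≤ Real.sin y := Real.mul_le_sin hy.le hy'
    have h2 : 0 < 2 / Real.pi * y := by positivity
    rw [abs_of_pos (h2.trans_le h1)]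
    refine (Real.rpow_le_rpow_of_nonpos h2 h1 (by linarith)).trans ?_
    rw [Real.mul_rpow (by positivity) hy.le]
    refine mul_le_mul_of_nonneg_right ?_ (by positivity)
    rw [Real.rpow_neg (by positivity), ← Real.inv_rpow (by positivity), inv_div]
    calc (Real.pi / 2) ^ p ≤ 2 ^ p :=
          Real.rpow_le_rpow (by positivity) (by linarith [Real.pi_lt_four]) hp
      _ ≤ 2 := by simpa using Real.rpow_le_rpow_of_exponent_le (x := 2) (by norm_num) hp1
  have h1 : 0 < x ^ (-p) := Real.rpow_pos_of_pos hx _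
  have h2 : 0 < (Real.pi - x) ^ (-p) := Real.rpow_pos_of_pos (by linarith) _
  rcases le_total x (Real.pi / 2) with h | h
  · linarith [key x hx h]
  · have := key (Real.pi - x) (by linarith) (by linarith)
    rw [Real.sin_pi_sub] at this
    linarith

theorem periodic_abs_sin_rpow (p : ℝ) :
    Function.Periodic (fun x => |Real.sin x| ^ (-p)) Real.pi := fun x => by
  simp [Real.sin_add_pi]

theorem intervalIntegrable_rpow_neg {p : ℝ} (hp1 : p < 1) :
    IntervalIntegrable (fun x : ℝ => 2 * (x ^ (-p) + (Real.pi - x) ^ (-p))) volume 0 Real.pi := by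
  have h1 : IntervalIntegrable (fun x : ℝ => x ^ (-p)) volume 0 Real.pi :=
    intervalIntegral.intervalIntegrable_rpow' (by linarith)
  have h2 : IntervalIntegrable (fun x : ℝ => (Real.pi - x) ^ (-p)) volume 0 Real.pi := by
    simpa using (h1.comp_sub_left Real.pi).symm
  exact (h1.add h2).const_mul 2

theorem intervalIntegrable_abs_sin_rpow {p : ℝ} (hp : 0 ≤ p) (hp1 : p < 1) (a b : ℝ) :
    IntervalIntegrable (fun x => |Real.sin x| ^ (-p)) volume a b := by
  refine (periodic_abs_sin_rpow p).intervalIntegrable Real.pi_pos.ne' (t := 0) ?_ a b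
  rw [zero_add]
  refine (intervalIntegrable_rpow_neg hp1).mono_fun ?_ ?_
  · exact ((Real.measurable_sin.abs).pow_const _).aestronglyMeasurable
  · rw [Set.uIoc_of_le Real.pi_pos.le, ← restrict_Ioo_eq_restrict_Ioc]
    filter_upwards [ae_restrict_mem measurableSet_Ioo] with x hx
    rw [Real.norm_eq_abs, Real.norm_eq_abs, abs_of_nonneg (by positivity)]
    exact (abs_sin_rpow_le hp hp1.le hx.1 hx.2).trans (le_abs_self _)

theorem integral_abs_sin_rpow_le {p : ℝ} (hp : 0 ≤ p) (hp1 : p < 1) :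
    ∫ x in (0 : ℝ)..Real.pi, |Real.sin x| ^ (-p) ≤ 16 / (1 - p) := by
  have h1 : ∫ x in (0 : ℝ)..Real.pi, |Real.sin x| ^ (-p) ≤
      ∫ x in (0 : ℝ)..Real.pi, 2 * (x ^ (-p) + (Real.pi - x) ^ (-p)) :=
    intervalIntegral.integral_mono_on_of_le_Ioo Real.pi_pos.le
      (intervalIntegrable_abs_sin_rpow hp hp1 _ _) (intervalIntegrable_rpow_neg hp1)
      fun x hx => abs_sin_rpow_le hp hp1.le hx.1 hx.2
  have hi : IntervalIntegrable (fun x : ℝ => x ^ (-p)) volume 0 Real.pi :=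
    intervalIntegral.intervalIntegrable_rpow' (by linarith)
  have hi2 : IntervalIntegrable (fun x : ℝ => (Real.pi - x) ^ (-p)) volume 0 Real.pi := by
    simpa using (hi.comp_sub_left Real.pi).symm
  rw [intervalIntegral.integral_const_mul, intervalIntegral.integral_add hi hi2,
    intervalIntegral.integral_comp_sub_left (fun x => x ^ (-p)), sub_self, sub_zero,
    integral_rpow (Or.inl (by linarith)), Real.zero_rpow (by linarith)] at h1
  have h2 : Real.pi ^ (-p + 1) ≤ 4 := by
    calc Real.pi ^ (-p + 1) ≤ Real.pi ^ (1 : ℝ) :=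
          Real.rpow_le_rpow_of_exponent_le (by linarith [Real.pi_gt_three]) (by linarith)
      _ ≤ 4 := by rw [Real.rpow_one]; exact Real.pi_le_four
  refine h1.trans ?_
  rw [sub_zero, ← add_div, mul_div_assoc', neg_add_eq_sub]
  exact div_le_div_of_nonneg_right (by rw [neg_add_eq_sub] at h2; linarith) (by linarith)

theorem lintegral_abs_sin_sub_rpow_le {p : ℝ} (hp : 0 ≤ p) (hp1 : p < 1) (β : ℝ) :
    ∫⁻ θ in Set.Ioc 0 (2 * Real.pi), ENNReal.ofReal (|Real.sin (θ - β)| ^ (-p)) ≤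
      ENNReal.ofReal (32 / (1 - p)) := by
  have hint : IntervalIntegrable (fun x => |Real.sin (x - β)| ^ (-p)) volume 0 (2 * Real.pi) := by
    simpa using (intervalIntegrable_abs_sin_rpow hp hp1 (0 - β) (2 * Real.pi - β)).comp_sub_right β
  rw [intervalIntegrable_iff_integrableOn_Ioc_of_le Real.two_pi_pos.le] at hint
  rw [← ofReal_integral_eq_lintegral_ofReal hint
    (Eventually.of_forall fun x => by positivity)]
  refine ENNReal.ofReal_le_ofReal ?_
  rw [← intervalIntegral.integral_of_le Real.two_pi_pos.le,
    intervalIntegral.integral_comp_sub_right (fun x => |Real.sin x| ^ (-p)),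
    ← intervalIntegral.integral_add_adjacent_intervals (b := -β + Real.pi)
      (intervalIntegrable_abs_sin_rpow hp hp1 _ _) (intervalIntegrable_abs_sin_rpow hp hp1 _ _)]
  have e1 : 2 * Real.pi - β = (-β + Real.pi) + Real.pi := by ring
  have h0 := integral_abs_sin_rpow_le hp hp1
  rw [e1, zero_sub, (periodic_abs_sin_rpow p).intervalIntegral_add_eq (-β) 0,
    (periodic_abs_sin_rpow p).intervalIntegral_add_eq (-β + Real.pi) 0, zero_add]
  have : (32 : ℝ) / (1 - p) = 16 / (1 - p) + 16 / (1 - p) := by ring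
  linarith

/-! ### The majorant along almost every radius. -/

theorem lintegral_posLog_circleMap {f : ℂ → ℂ} {R : ℝ} (hf : MeromorphicOn f (sphere 0 |R|)) :
    ∫⁻ φ in Set.Ioc 0 (2 * Real.pi), ENNReal.ofReal (Real.posLog ‖f (circleMap 0 R φ)‖) =
      ENNReal.ofReal (2 * Real.pi * ValueDistribution.proximity f ⊤ R) := by
  have hint : CircleIntegrable (fun z => Real.posLog ‖f z‖) 0 R := circleIntegrable_posLog_norm hf
  unfold CircleIntegrable at hint
  rw [intervalIntegrable_iff_integrableOn_Ioc_of_le Real.two_pi_pos.le] at hint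
  rw [← ofReal_integral_eq_lintegral_ofReal hint (Eventually.of_forall fun x => Real.posLog_nonneg),
    ← intervalIntegral.integral_of_le Real.two_pi_pos.le, ValueDistribution.proximity_top,
    Real.circleAverage_def, smul_eq_mul, mul_inv_cancel_left₀ Real.two_pi_pos.ne']

/-- A pointwise bound for `log⁺ ‖g‖` on a circle by a function with a bounded integral bounds the
proximity function. -/
theorem proximity_le_of_ae_le {g : ℂ → ℂ} {r a B k : ℝ} {W : ℝ → ℝ≥0∞}
    (hg : MeromorphicOn g (sphere 0 |r|)) (ha : 0 ≤ a) (hB : 0 ≤ B) (hk : 0 ≤ k)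
    (hW : ∫⁻ θ in Set.Ioc 0 (2 * Real.pi), W θ ≤ ENNReal.ofReal B)
    (h : ∀ᵐ θ, ENNReal.ofReal (Real.posLog ‖g (circleMap 0 r θ)‖) ≤
      ENNReal.ofReal a + ENNReal.ofReal k * W θ) :
    ValueDistribution.proximity g ⊤ r ≤ a + k * B := by
  have h1 : ENNReal.ofReal (2 * Real.pi * ValueDistribution.proximity g ⊤ r) ≤
      ENNReal.ofReal (2 * Real.pi * a + k * B) := by
    rw [← lintegral_posLog_circleMap hg]
    refine (lintegral_mono_ae (ae_restrict_of_ae h)).trans ?_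
    rw [lintegral_add_left measurable_const, lintegral_const_mul' _ _ ENNReal.ofReal_ne_top,
      setLIntegral_const, Real.volume_Ioc, sub_zero, ENNReal.ofReal_add (by positivity)
      (by positivity), ENNReal.ofReal_mul hk, mul_comm (ENNReal.ofReal a),
      ENNReal.ofReal_mul Real.two_pi_pos.le]
    gcongr
  rw [ENNReal.ofReal_le_ofReal_iff (by positivity)] at h1
  have h2 : (1 : ℝ) ≤ 2 * Real.pi := by linarith [Real.pi_gt_three]
  have h3 : k * B ≤ 2 * Real.pi * (k * B) := le_mul_of_one_le_left (by positivity) h2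
  have h4 : 2 * Real.pi * ValueDistribution.proximity g ⊤ r ≤ 2 * Real.pi * (a + k * B) := by
    linarith
  exact le_of_mul_le_mul_left h4 Real.two_pi_pos

/-- The convolution of `log⁺ ‖f‖` on the circle `|z| = R` with the kernel `|sin| ^ (-p)`. -/
noncomputable def sinConvolution (f : ℂ → ℂ) (R p θ : ℝ) : ℝ≥0∞ :=
  ∫⁻ φ in Set.Ioc 0 (2 * Real.pi), ENNReal.ofReal (|Real.sin (θ - φ)| ^ (-p)) *
    ENNReal.ofReal (Real.posLog ‖f (circleMap 0 R φ)‖)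

/-- Tonelli's theorem: the mass of the kernel times the integral of log⁺|f|. -/
theorem lintegral_sinConvolution_le {f : ℂ → ℂ} {R p : ℝ} (hf : MeromorphicOn f (sphere 0 |R|))
    (hp : 0 ≤ p) (hp1 : p < 1) :
    ∫⁻ θ in Set.Ioc 0 (2 * Real.pi), sinConvolution f R p θ ≤
      ENNReal.ofReal (32 / (1 - p) * (2 * Real.pi * ValueDistribution.proximity f ⊤ R)) := by
  have hint : CircleIntegrable (fun z => Real.posLog ‖f z‖) 0 R := circleIntegrable_posLog_norm hf
  unfold CircleIntegrable at hint
  rw [intervalIntegrable_iff_integrableOn_Ioc_of_le Real.two_pi_pos.le] at hint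
  have hF : AEMeasurable (fun φ => ENNReal.ofReal (Real.posLog ‖f (circleMap 0 R φ)‖))
      (volume.restrict (Set.Ioc 0 (2 * Real.pi))) :=
    hint.aestronglyMeasurable.aemeasurable.ennreal_ofReal
  have hK : Measurable fun q : ℝ × ℝ => ENNReal.ofReal (|Real.sin (q.1 - q.2)| ^ (-p)) := by
    fun_prop
  unfold sinConvolution
  rw [lintegral_lintegral_swap]
  · rw [ENNReal.ofReal_mul (div_nonneg (by norm_num) (by linarith)),
      ← lintegral_posLog_circleMap hf, ← lintegral_const_mul' _ _ ENNReal.ofReal_ne_top]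
    refine lintegral_mono fun φ => ?_
    rw [lintegral_mul_const' _ _ ENNReal.ofReal_ne_top]
    gcongr
    exact lintegral_abs_sin_sub_rpow_le hp hp1 φ
  · exact hK.aemeasurable.mul hF.comp_snd

theorem ofReal_poissonPosLog_le {f : ℂ → ℂ} {R κ p t θ : ℝ} (hf : MeromorphicOn f (sphere 0 |R|))
    (hR : 1 / 2 ≤ R) (hR1 : R ≤ 1) (hκ : 0 < κ)
    (hp : 1 / 2 ≤ p) (hp1 : p < 1) (hκp : κ ^ (p - 1) ≤ 3) (ht : 0 ≤ t) (htR : t ≤ R - 2 * κ) :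
    ENNReal.ofReal (poissonPosLog f R (circleMap 0 t θ)) ≤ 12 * sinConvolution f R p θ := by
  have hw : circleMap 0 t θ ∈ ball (0 : ℂ) R := by
    simp only [mem_ball, dist_zero_right, norm_circleMap_zero, abs_of_nonneg ht]
    linarith
  have hint := CircleIntegrable.poissonKernel_mul hw (circleIntegrable_posLog_norm hf)
  unfold CircleIntegrable at hint
  rw [intervalIntegrable_iff_integrableOn_Ioc_of_le Real.two_pi_pos.le] at hint
  have hnn : ∀ φ, 0 ≤ poissonKernel 0 (circleMap 0 t θ) (circleMap 0 R φ) *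
      Real.posLog ‖f (circleMap 0 R φ)‖ := fun φ =>
    mul_nonneg (poissonKernel_nonneg hw (circleMap_mem_sphere 0 (by linarith) φ)) Real.posLog_nonneg
  have h1 : poissonPosLog f R (circleMap 0 t θ) ≤ ∫ φ in Set.Ioc 0 (2 * Real.pi),
      poissonKernel 0 (circleMap 0 t θ) (circleMap 0 R φ) *
        Real.posLog ‖f (circleMap 0 R φ)‖ := by
    rw [poissonPosLog, Real.circleAverage_def, intervalIntegral.integral_of_le Real.two_pi_pos.le,
      smul_eq_mul]
    -- The normalising factor 1/(2π) of the circle average is simply dropped.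
    refine mul_le_of_le_one_left (integral_nonneg hnn) (inv_le_one_of_one_le₀ ?_)
    linarith [Real.pi_gt_three]
  refine (ENNReal.ofReal_le_ofReal h1).trans ?_
  rw [ofReal_integral_eq_lintegral_ofReal hint (Eventually.of_forall hnn), sinConvolution,
    ← lintegral_const_mul' _ _ (by norm_num)]
  refine lintegral_mono_ae (ae_restrict_of_ae ?_)
  filter_upwards [ae_sin_sub_ne_zero θ] with φ hφ
  rw [← ENNReal.ofReal_mul (by positivity)]
  have h12 : (12 : ℝ≥0∞) = ENNReal.ofReal 12 := by norm_num
  rw [h12, ← ENNReal.ofReal_mul (by norm_num), ← mul_assoc]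
  refine ENNReal.ofReal_le_ofReal (mul_le_mul_of_nonneg_right ?_ Real.posLog_nonneg)
  refine poissonKernel_circleMap_le hR hR1 hκ hp hp1 hκp ht htR ?_
  rw [← neg_sub, Real.sin_neg]
  exact neg_ne_zero.2 hφ

theorem log_norm_canonicalFactor_circleMap_le {R κ p t θ : ℝ} {b : ℂ} (hR : 0 < R) (hκ : 0 < κ)
    (hp : 1 / 2 ≤ p) (hp1 : p < 1) (hκp : κ ^ (p - 1) ≤ 3) (ht : 0 ≤ t) (htR : t ≤ R - 2 * κ)
    (hb0 : b ≠ 0) (hb : ‖b‖ ≤ R) (hsin : Real.sin (θ - b.arg) ≠ 0) :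
    Real.log ‖Complex.canonicalFactor R b (circleMap 0 t θ)‖ ≤
      12 * (R - ‖b‖) * ‖b‖ ^ (-p) * |Real.sin (θ - b.arg)| ^ (-p) := by
  have hbpos : 0 < ‖b‖ := norm_pos_iff.2 hb0
  have hspos : 0 < |Real.sin (θ - b.arg)| := abs_pos.2 hsin
  have h1 := norm_mul_abs_sin_le b t θ
  have h2 : circleMap 0 t θ ≠ b := by
    intro h
    rw [h, sub_self, norm_zero] at h1
    have : 0 < ‖b‖ * |Real.sin (θ - b.arg)| := by positivity
    linarith
  refine (log_norm_canonicalFactor_le hR hκ hp hp1 hκp hb ?_ h2).trans ?_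
  · rwa [norm_circleMap_zero, abs_of_nonneg ht]
  · rw [mul_assoc (12 * (R - ‖b‖)), ← Real.mul_rpow hbpos.le hspos.le]
    refine mul_le_mul_of_nonneg_left ?_ (by linarith)
    exact Real.rpow_le_rpow_of_nonpos (by positivity) h1 (by linarith)

/-- A pole at 0 lies on every ray, so the sine bound is useless for it; staying at t ≥ r₀ bounds its
Green function instead. -/
theorem log_norm_canonicalFactor_zero_le {R t r₀ θ : ℝ} (hR : 0 < R) (hR1 : R ≤ 1) (hr₀ : 0 < r₀)
    (ht : r₀ ≤ t) :
    Real.log ‖Complex.canonicalFactor R 0 (circleMap 0 t θ)‖ ≤ -Real.log r₀ := by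
  have ht0 : 0 < t := hr₀.trans_le ht
  have h1 : ‖Complex.canonicalFactor R 0 (circleMap 0 t θ)‖ = R / t := by
    rw [Complex.canonicalFactor_apply]
    simp only [map_zero, zero_mul, sub_zero, norm_div, norm_mul, norm_pow, Complex.norm_real,
      Real.norm_eq_abs, norm_circleMap_zero, abs_of_pos hR, abs_of_pos ht0]
    field_simp
  rw [h1, ← Real.log_inv]
  refine Real.log_le_log (by positivity) ?_
  rw [← one_div]
  exact div_le_div₀ zero_le_one hR1 hr₀ ht

/-- This turns the weight R - ‖b‖ of the Green function bound into a term of the counting function.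
-/
theorem sub_norm_le_posLog {R : ℝ} {b : ℂ} (hR : 0 < R) (hR1 : R ≤ 1) (hb0 : b ≠ 0) :
    R - ‖b‖ ≤ Real.posLog (R * ‖b‖⁻¹) := by
  have hb : 0 < ‖b‖ := norm_pos_iff.2 hb0
  rcases le_total R ‖b‖ with h | h
  · exact (sub_nonpos.2 h).trans Real.posLog_nonneg
  · refine le_trans ?_ (le_max_right _ _)
    have h1 := Real.one_sub_inv_le_log_of_pos (x := R * ‖b‖⁻¹) (by positivity)
    refine le_trans ?_ h1
    rw [mul_inv, inv_inv]
    have : R * (1 - R⁻¹ * ‖b‖) = R - ‖b‖ := by field_simp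
    rw [← this]
    refine mul_le_of_le_one_left ?_ hR1
    rw [sub_nonneg, inv_mul_le_iff₀ hR, mul_one]
    exact h

/-- The majorant, on the circle of directions, of the right-hand side of the Poisson–Jensen
inequality along a radius. -/
noncomputable def radialMajorant (f : ℂ → ℂ) (R p r₀ : ℝ) (S : Finset ℂ) (θ : ℝ) : ℝ≥0∞ :=
  12 * sinConvolution f R p θ +
    ∑ b ∈ S, ENNReal.ofReal (poleOrder f b * (12 / r₀ * Real.posLog (R * ‖b‖⁻¹))) *
      ENNReal.ofReal (|Real.sin (θ - b.arg)| ^ (-p)) +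
    ENNReal.ofReal (poleOrder f 0 * -Real.log r₀)

theorem ae_le_radialMajorant {f : ℂ → ℂ} {R κ p r₀ : ℝ} {S : Finset ℂ}
    (hf : MeromorphicOn f (closedBall 0 R)) (hS : ∀ b, b ∈ S ↔ ‖b‖ ≤ R ∧ poleOrder f b ≠ 0)
    (hr₀ : 0 < r₀) (hr₁ : r₀ ≤ 1) (hSr : ∀ b ∈ S, b ≠ 0 → r₀ ≤ ‖b‖)
    (hR : 1 / 2 ≤ R) (hR1 : R ≤ 1) (hκ : 0 < κ)
    (hp : 1 / 2 ≤ p) (hp1 : p < 1) (hκp : κ ^ (p - 1) ≤ 3) :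
    ∀ᵐ θ, ∀ t, r₀ ≤ t → t ≤ R - 2 * κ →
      ENNReal.ofReal (poissonPosLog f R (circleMap 0 t θ) + ∑ b ∈ S, poleOrder f b *
        Real.log ‖Complex.canonicalFactor R b (circleMap 0 t θ)‖) ≤
        radialMajorant f R p r₀ S θ := by
  have hR0 : 0 < R := by linarith
  have hsph : MeromorphicOn f (sphere 0 |R|) := by
    rw [abs_of_pos hR0]
    exact hf.mono_set sphere_subset_closedBall
  have hlog : 0 ≤ -Real.log r₀ := neg_nonneg.2 (Real.log_nonpos hr₀.le hr₁)
  have hsin : ∀ᵐ θ, ∀ b ∈ S, Real.sin (θ - b.arg) ≠ 0 :=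
    (ae_ball_iff S.countable_toSet).2 fun b _ => ae_sin_sub_ne_zero _
  filter_upwards [hsin] with θ hθ t ht htR
  have ht0 : 0 ≤ t := hr₀.le.trans ht
  have hw : ‖circleMap 0 t θ‖ ≤ R := by
    rw [norm_circleMap_zero, abs_of_nonneg ht0]; linarith
  have hterm : ∀ b ∈ S, ENNReal.ofReal (poleOrder f b *
      Real.log ‖Complex.canonicalFactor R b (circleMap 0 t θ)‖) ≤
      ENNReal.ofReal (poleOrder f b * (12 / r₀ * Real.posLog (R * ‖b‖⁻¹))) *
      ENNReal.ofReal (|Real.sin (θ - b.arg)| ^ (-p)) +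
      if b = 0 then ENNReal.ofReal (poleOrder f 0 * -Real.log r₀) else 0 := by
    intro b hb
    have hbR := ((hS b).1 hb).1
    split_ifs with h
    · subst h
      refine le_add_left (ENNReal.ofReal_le_ofReal (mul_le_mul_of_nonneg_left ?_ (by positivity)))
      exact log_norm_canonicalFactor_zero_le hR0 hR1 hr₀ ht
    · rw [add_zero, ← ENNReal.ofReal_mul
        (mul_nonneg (by positivity) (mul_nonneg (by positivity) Real.posLog_nonneg)), mul_assoc]
      refine ENNReal.ofReal_le_ofReal (mul_le_mul_of_nonneg_left ?_ (by positivity))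
      refine (log_norm_canonicalFactor_circleMap_le hR0 hκ hp hp1 hκp ht0 htR h hbR
        (hθ b hb)).trans (mul_le_mul_of_nonneg_right ?_ (by positivity))
      have hbr := hSr b hb h
      have h1 : ‖b‖ ^ (-p) ≤ r₀⁻¹ := by
        have h3 : ‖b‖ ^ (-p) ≤ r₀ ^ (-p) := Real.rpow_le_rpow_of_nonpos hr₀ hbr (by linarith)
        have h4 : r₀ ^ (-p) ≤ r₀ ^ (-1 : ℝ) :=
          Real.rpow_le_rpow_of_exponent_ge hr₀ hr₁ (by linarith)
        rw [Real.rpow_neg_one] at h4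
        exact h3.trans h4
      have h2 := sub_norm_le_posLog hR0 hR1 h
      calc 12 * (R - ‖b‖) * ‖b‖ ^ (-p) ≤ 12 * Real.posLog (R * ‖b‖⁻¹) * r₀⁻¹ := by
            refine mul_le_mul (by linarith) h1 (by positivity) ?_
            exact mul_nonneg (by norm_num) Real.posLog_nonneg
        _ = 12 / r₀ * Real.posLog (R * ‖b‖⁻¹) := by ring
  refine ENNReal.ofReal_add_le.trans ?_
  unfold radialMajorant
  rw [add_assoc]
  refine add_le_add (ofReal_poissonPosLog_le hsph hR hR1 hκ hp hp1 hκp ht0 htR) ?_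
  rw [ENNReal.ofReal_sum_of_nonneg fun b hb => mul_nonneg (by positivity)
    (log_norm_canonicalFactor_nonneg hR0 ((hS b).1 hb).1 hw)]
  refine (Finset.sum_le_sum hterm).trans ?_
  rw [Finset.sum_add_distrib]
  refine add_le_add le_rfl ?_
  rw [Finset.sum_ite_eq' S (0 : ℂ)]
  split_ifs <;> simp

/-- The constant is 3072 = 12 · 32 · 8: kernel bound, mass of the sine kernel, and 2π ≤ 8. -/
theorem lintegral_radialMajorant_le {f : ℂ → ℂ} {R p r₀ : ℝ} {S : Finset ℂ}
    (hf : MeromorphicOn f (closedBall 0 R)) (hS : ∀ b, b ∈ S ↔ ‖b‖ ≤ R ∧ poleOrder f b ≠ 0)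
    (hr₀ : 0 < r₀) (hr₁ : r₀ ≤ 1)
    (hR : 1 / 2 ≤ R) (hp : 1 / 2 ≤ p) (hp1 : p < 1) :
    ∫⁻ θ in Set.Ioc 0 (2 * Real.pi), radialMajorant f R p r₀ S θ ≤
      ENNReal.ofReal (1 / (1 - p) * (3072 / r₀ *
        (nevanlinnaT f R + poleOrder f 0 * (Real.log 2 - Real.log r₀)))) := by
  have hR0 : 0 < R := by linarith
  have hsph : MeromorphicOn f (sphere 0 |R|) := by
    rw [abs_of_pos hR0]
    exact hf.mono_set sphere_subset_closedBall
  have hlog : 0 ≤ -Real.log r₀ := neg_nonneg.2 (Real.log_nonpos hr₀.le hr₁)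
  have h32 : 0 ≤ 32 / (1 - p) := div_nonneg (by norm_num) (by linarith)
  have hm := proximity_top_nonneg f R
  have hpi := Real.pi_pos
  set A := ∑ b ∈ S, (poleOrder f b : ℝ) * Real.posLog (R * ‖b‖⁻¹) with hA
  have hA0 : 0 ≤ A := Finset.sum_nonneg fun b _ => mul_nonneg (by positivity) Real.posLog_nonneg
  have hcoef : ∀ b, 0 ≤ (poleOrder f b : ℝ) * (12 / r₀ * Real.posLog (R * ‖b‖⁻¹)) := fun b =>
    mul_nonneg (by positivity) (mul_nonneg (by positivity) Real.posLog_nonneg)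
  have h1 : ∫⁻ θ in Set.Ioc 0 (2 * Real.pi), radialMajorant f R p r₀ S θ ≤
      ENNReal.ofReal (12 * (32 / (1 - p) * (2 * Real.pi * ValueDistribution.proximity f ⊤ R)) +
        12 / r₀ * A * (32 / (1 - p)) + poleOrder f 0 * -Real.log r₀ * (2 * Real.pi)) := by
    unfold radialMajorant
    have hmeas : Measurable fun θ : ℝ => ∑ b ∈ S,
        ENNReal.ofReal (poleOrder f b * (12 / r₀ * Real.posLog (R * ‖b‖⁻¹))) *
        ENNReal.ofReal (|Real.sin (θ - b.arg)| ^ (-p)) := by fun_prop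
    rw [lintegral_add_right _ measurable_const, lintegral_add_right _ hmeas,
      lintegral_const_mul' _ _ (by norm_num), setLIntegral_const, Real.volume_Ioc, sub_zero,
      lintegral_finsetSum _ (fun b _ => by fun_prop),
      ENNReal.ofReal_add (by positivity) (by positivity),
      ENNReal.ofReal_add (by positivity) (by positivity)]
    refine add_le_add (add_le_add ?_ ?_) ?_
    · rw [ENNReal.ofReal_mul (by norm_num)]
      refine mul_le_mul' (by norm_num) (lintegral_sinConvolution_le hsph (by linarith) hp1)
    · have : 12 / r₀ * A * (32 / (1 - p)) = ∑ b ∈ S, (poleOrder f b : ℝ) *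
          (12 / r₀ * Real.posLog (R * ‖b‖⁻¹)) * (32 / (1 - p)) := by
        rw [hA, Finset.mul_sum, Finset.sum_mul]
        exact Finset.sum_congr rfl fun b _ => by ring
      rw [this, ENNReal.ofReal_sum_of_nonneg fun b _ => mul_nonneg (hcoef b) h32]
      refine Finset.sum_le_sum fun b _ => ?_
      rw [lintegral_const_mul' _ _ ENNReal.ofReal_ne_top, ENNReal.ofReal_mul (hcoef b)]
      gcongr
      exact lintegral_abs_sin_sub_rpow_le (by linarith) hp1 _
    · rw [← ENNReal.ofReal_mul (by positivity)]
  refine h1.trans (ENNReal.ofReal_le_ofReal ?_)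
  have hN := poleCounting_eq_sum hR0 hf (fun b hb h => (hS b).2 ⟨hb, h⟩)
  rw [nevanlinnaT, hN, ← hA]
  -- The counting function contains n₀ log R, which may be negative; since R ≥ 1/2, adding n₀ log 2
  -- compensates for it.
  have hlogR := mul_nonneg (Nat.cast_nonneg (α := ℝ) (poleOrder f 0))
    (log_two_mul_nonneg_of_half_le hR)
  set m := ValueDistribution.proximity f ⊤ R
  set n₀ : ℝ := (poleOrder f 0 : ℝ)
  have hx : 1 ≤ 1 / (1 - p) := by rw [le_div_iff₀ (by linarith)]; linarith
  have hy : 1 ≤ 1 / r₀ := by rw [le_div_iff₀ hr₀]; linarith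
  have e1 : 12 * (32 / (1 - p) * (2 * Real.pi * m)) + 12 / r₀ * A * (32 / (1 - p)) +
      n₀ * -Real.log r₀ * (2 * Real.pi) = (1 / (1 - p)) * (384 * (2 * Real.pi) * m +
        384 * (1 / r₀) * A) + n₀ * -Real.log r₀ * (2 * Real.pi) := by ring
  have e2 : n₀ * -Real.log r₀ * (2 * Real.pi) ≤ (1 / (1 - p)) * (3072 * (1 / r₀) *
      (n₀ * -Real.log r₀)) := by
    have h5 : 0 ≤ n₀ * -Real.log r₀ := by positivity
    have h6 : 2 * Real.pi ≤ 3072 * (1 / r₀) := by linarith [Real.pi_le_four]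
    calc n₀ * -Real.log r₀ * (2 * Real.pi) ≤ n₀ * -Real.log r₀ * (3072 * (1 / r₀)) :=
          mul_le_mul_of_nonneg_left h6 h5
      _ = 1 * (3072 * (1 / r₀) * (n₀ * -Real.log r₀)) := by ring
      _ ≤ _ := mul_le_mul_of_nonneg_right hx (by positivity)
  have e3 : 384 * (2 * Real.pi) * m ≤ 3072 * (1 / r₀) * m := by
    refine mul_le_mul_of_nonneg_right ?_ hm
    linarith [Real.pi_le_four]
  have e4 : 384 * (1 / r₀) * A ≤ 3072 * (1 / r₀) * A := by
    refine mul_le_mul_of_nonneg_right ?_ hA0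
    linarith
  have e5 : 0 ≤ 3072 * (1 / r₀) * (n₀ * (Real.log R + Real.log 2)) := by positivity
  rw [e1]
  have e6 : (1 / (1 - p)) * (384 * (2 * Real.pi) * m + 384 * (1 / r₀) * A) ≤
      (1 / (1 - p)) * (3072 * (1 / r₀) * m + 3072 * (1 / r₀) * A +
        3072 * (1 / r₀) * (n₀ * (Real.log R + Real.log 2))) :=
    mul_le_mul_of_nonneg_left (by linarith) (by linarith)
  refine (add_le_add e6 e2).trans (le_of_eq ?_)
  ring

/-- A ray in direction θ meets b only if sin(θ - arg b) = 0, which holds for countably many θ. -/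
theorem ae_circleMap_notMem_of_countable {Z : Set ℂ} (hZ : Z.Countable) :
    ∀ᵐ θ, ∀ t : ℝ, 0 < t → circleMap 0 t θ ∉ Z := by
  have h : ∀ᵐ θ, ∀ b ∈ Z, Real.sin (θ - b.arg) ≠ 0 :=
    (ae_ball_iff hZ).2 fun b _ => ae_sin_sub_ne_zero _
  filter_upwards [h] with θ hθ t ht hmem
  have h1 := norm_mul_abs_sin_le (circleMap 0 t θ) t θ
  rw [sub_self, norm_zero, norm_circleMap_zero, abs_of_pos ht] at h1
  have h2 := abs_pos.2 (hθ _ hmem)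
  have : 0 < t * |Real.sin (θ - (circleMap 0 t θ).arg)| := by positivity
  linarith

theorem MeromorphicOn.ae_analyticAt_circleMap {f : ℂ → ℂ} (hf : MeromorphicOn f (ball 0 1)) :
    ∀ᵐ θ, ∀ t : ℝ, 0 < t → t < 1 → AnalyticAt ℂ f (circleMap 0 t θ) := by
  filter_upwards [ae_circleMap_notMem_of_countable hf.countable_compl_analyticAt_inter]
    with θ hθ t ht ht1
  by_contra hc
  refine hθ t ht ⟨hc, ?_⟩
  simpa [abs_of_pos ht] using ht1

theorem MeromorphicAt.exists_forall_analyticAt {f : ℂ → ℂ} (hf : MeromorphicAt f 0) :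
    ∃ r₀ : ℝ, 0 < r₀ ∧ r₀ ≤ 1 / 2 ∧ ∀ z : ℂ, z ≠ 0 → ‖z‖ ≤ r₀ → AnalyticAt ℂ f z := by
  have h := hf.eventually_analyticAt
  rw [eventually_nhdsWithin_iff, Metric.eventually_nhds_iff] at h
  obtain ⟨ε, hε, h⟩ := h
  refine ⟨min (ε / 2) (1 / 2), by positivity, min_le_right _ _, fun z hz hzr => h ?_ hz⟩
  rw [dist_zero_right]
  linarith [min_le_left (ε / 2) (1 / 2)]

theorem tendsto_log_four_div : Tendsto (fun r : ℝ => Real.log (4 / (1 - r))) (𝓝[<] 1) atTop := by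
  refine Real.tendsto_log_atTop.comp ?_
  have := tendsto_one_div_one_sub.const_mul_atTop (show (0 : ℝ) < 4 by norm_num)
  simpa [div_eq_mul_inv] using this

/-- Along almost every radius, the right-hand side of the Poisson–Jensen inequality is bounded by
a function whose mean is controlled by the characteristic. -/
theorem exists_majorant {f : ℂ → ℂ} (hf : MeromorphicOn f (ball 0 1)) {r₀ : ℝ} (hr₀ : 0 < r₀)
    (hr₁ : r₀ ≤ 1 / 2) (han : ∀ z : ℂ, z ≠ 0 → ‖z‖ ≤ r₀ → AnalyticAt ℂ f z) :
    ∃ C : ℝ, 0 ≤ C ∧ ∀ᶠ r in 𝓝[<] (1 : ℝ), ∀ S : Finset ℂ,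
      (∀ b, b ∈ S ↔ ‖b‖ ≤ (1 + r) / 2 ∧ poleOrder f b ≠ 0) → ∃ W : ℝ → ℝ≥0∞,
      ∫⁻ θ in Set.Ioc 0 (2 * Real.pi), W θ ≤
        ENNReal.ofReal (C * Real.log (4 / (1 - r)) * (|nevanlinnaT f ((1 + r) / 2)| + C)) ∧
      ∀ᵐ θ, ∀ t, r₀ ≤ t → t ≤ r →
        ENNReal.ofReal (poissonPosLog f ((1 + r) / 2) (circleMap 0 t θ) + ∑ b ∈ S, poleOrder f b *
          Real.log ‖Complex.canonicalFactor ((1 + r) / 2) b (circleMap 0 t θ)‖) ≤ W θ := by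
  have hlog : 0 ≤ -Real.log r₀ := neg_nonneg.2 (Real.log_nonpos hr₀.le (by linarith))
  have hlog2 := Real.log_nonneg one_le_two
  set c : ℝ := poleOrder f 0 * (Real.log 2 - Real.log r₀) with hc
  have hc0 : 0 ≤ c := mul_nonneg (by positivity) (by linarith)
  refine ⟨3072 / r₀ + c, by positivity, ?_⟩
  filter_upwards [tendsto_log_four_div.eventually_ge_atTop 2, self_mem_nhdsWithin,
    mem_nhdsWithin_of_mem_nhds (Ioi_mem_nhds (show (0 : ℝ) < 1 by norm_num))]
    with r hL hr1 hr0 S hS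
  have hr1 : r < 1 := hr1
  have hr0 : 0 < r := hr0
  set L := Real.log (4 / (1 - r)) with hLdef
  have hL0 : 0 < L := by linarith
  have hκ : 0 < (1 - r) / 4 := by linarith
  have hp : 1 / 2 ≤ 1 - 1 / L := by
    have : 1 / L ≤ 1 / 2 := one_div_le_one_div_of_le two_pos hL
    linarith
  have hp1 : 1 - 1 / L < 1 := by
    have : 0 < 1 / L := by positivity
    linarith
  -- With κ = (1 - r)/4 and p = 1 - 1/L, the power κ^(p - 1) equals e exactly, while 1/(1 - p) = L
  -- is the logarithmic factor.
  have hκp : ((1 - r) / 4) ^ (1 - 1 / L - 1) ≤ 3 := by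
    have h1 : Real.log ((1 - r) / 4) = -L := by rw [hLdef, ← Real.log_inv, inv_div]
    rw [Real.rpow_def_of_pos hκ, h1]
    have h2 : -L * (1 - 1 / L - 1) = 1 := by field_simp; ring
    rw [h2]
    linarith [Real.exp_one_lt_d9]
  have hfR : MeromorphicOn f (closedBall 0 ((1 + r) / 2)) :=
    hf.mono_set (closedBall_subset_ball (by linarith))
  have hSr : ∀ b ∈ S, b ≠ 0 → r₀ ≤ ‖b‖ := fun b hb hb0 => by
    by_contra hlt
    push Not at hlt
    exact ((hS b).1 hb).2 (han b hb0 hlt.le).poleOrder_eq_zero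
  refine ⟨radialMajorant f ((1 + r) / 2) (1 - 1 / L) r₀ S, ?_, ?_⟩
  · refine (lintegral_radialMajorant_le hfR hS hr₀ (by linarith) (by linarith) hp hp1).trans
      (ENNReal.ofReal_le_ofReal ?_)
    rw [sub_sub_cancel, one_div_one_div, ← hc]
    have h1 : nevanlinnaT f ((1 + r) / 2) + c ≤
        |nevanlinnaT f ((1 + r) / 2)| + (3072 / r₀ + c) := by
      have : 0 ≤ 3072 / r₀ := by positivity
      linarith [le_abs_self (nevanlinnaT f ((1 + r) / 2))]
    calc L * (3072 / r₀ * (nevanlinnaT f ((1 + r) / 2) + c))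
        ≤ L * (3072 / r₀ * (|nevanlinnaT f ((1 + r) / 2)| + (3072 / r₀ + c))) := by gcongr
      _ ≤ L * ((3072 / r₀ + c) * (|nevanlinnaT f ((1 + r) / 2)| + (3072 / r₀ + c))) := by
          gcongr
          linarith
      _ = _ := by ring
  · filter_upwards [ae_le_radialMajorant hfR hS hr₀ (by linarith) hSr (by linarith) (by linarith)
      hκ hp hp1 hκp] with θ hθ t ht htr
    exact hθ t ht (by linarith)

/-! ### Bounding the characteristic of f by that of f'. -/

theorem LogComparable.of_le {T₁ T₂ : ℝ → ℝ} {C : ℝ}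
    (h : ∀ᶠ r in 𝓝[<] (1 : ℝ),
      T₁ r ≤ C * Real.log (4 / (1 - r)) * (|T₂ ((1 + r) / 2)| + C))
    (h' : ∀ᶠ r in 𝓝[<] (1 : ℝ), -1 ≤ T₁ r) : LogComparable T₁ T₂ := by
  refine ⟨max |C| 1, le_max_right _ _, ?_⟩
  filter_upwards [h, h', tendsto_log_four_div.eventually_ge_atTop 1] with r h1 h2 h3
  set L := Real.log (4 / (1 - r))
  set K := max |C| 1
  have hK : 1 ≤ K := le_max_right _ _
  have hCK : |C| ≤ K := le_max_left _ _
  have hT := abs_nonneg (T₂ ((1 + r) / 2))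
  have h4 : 1 ≤ K * L * (|T₂ ((1 + r) / 2)| + K) :=
    one_le_mul_of_one_le_of_one_le (one_le_mul_of_one_le_of_one_le hK h3) (by linarith)
  have h5 : C * L * (|T₂ ((1 + r) / 2)| + C) ≤ K * L * (|T₂ ((1 + r) / 2)| + K) := by
    refine (le_abs_self _).trans ?_
    rw [abs_mul, abs_mul, abs_of_nonneg (by linarith : 0 ≤ L)]
    have h6 : |(|T₂ ((1 + r) / 2)| + C)| ≤ |T₂ ((1 + r) / 2)| + K := by
      refine (abs_add_le _ _).trans ?_
      rw [abs_abs]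
      linarith
    gcongr
  exact abs_le.2 ⟨by linarith, h1.trans h5⟩

theorem hasDerivAt_comp_circleMap_radius {f : ℂ → ℂ} {t θ : ℝ}
    (hf : AnalyticAt ℂ f (circleMap 0 t θ)) :
    HasDerivAt (fun s : ℝ => f (circleMap 0 s θ))
      (deriv f (circleMap 0 t θ) * Complex.exp (θ * Complex.I)) t := by
  have h1 : HasDerivAt (fun s : ℝ => circleMap 0 s θ) (Complex.exp (θ * Complex.I)) t := by
    have : HasDerivAt (fun s : ℝ => (s : ℂ) * Complex.exp (θ * Complex.I))
        (1 * Complex.exp (θ * Complex.I)) t := Complex.ofRealCLM.hasDerivAt.mul_const _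
    simpa [circleMap] using this
  exact hf.differentiableAt.hasDerivAt.comp t h1

/-- Integration of `f'` along a radius on which it is bounded. -/
theorem posLog_norm_le_of_posLog_norm_deriv_le {f : ℂ → ℂ} {r₀ r θ M w : ℝ} (hr₀ : 0 ≤ r₀)
    (hr : r₀ ≤ r) (hr1 : r ≤ 1)
    (hf : ∀ t, r₀ ≤ t → t ≤ r → AnalyticAt ℂ f (circleMap 0 t θ))
    (hM : Real.posLog ‖f (circleMap 0 r₀ θ)‖ ≤ M) (hw0 : 0 ≤ w)
    (hw : ∀ t, r₀ ≤ t → t ≤ r → Real.posLog ‖deriv f (circleMap 0 t θ)‖ ≤ w) :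
    Real.posLog ‖f (circleMap 0 r θ)‖ ≤ w + M + Real.log 2 := by
  have hbound : ∀ t ∈ Set.Ico r₀ r,
      ‖deriv f (circleMap 0 t θ) * Complex.exp (θ * Complex.I)‖ ≤ Real.exp w := fun t ht => by
    rw [norm_mul, Complex.norm_exp_ofReal_mul_I, mul_one]
    have := hw t ht.1 ht.2.le
    rw [Real.posLog_eq_log_max_one (norm_nonneg _), Real.log_le_iff_le_exp (by positivity)] at this
    exact (le_max_right _ _).trans this
  have h1 := norm_image_sub_le_of_norm_deriv_le_segment'
    (fun t ht => (hasDerivAt_comp_circleMap_radius (hf t ht.1 ht.2)).hasDerivWithinAt) hbound r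
    (Set.right_mem_Icc.2 hr)
  have h2 : ‖f (circleMap 0 r θ) - f (circleMap 0 r₀ θ)‖ ≤ Real.exp w :=
    h1.trans (mul_le_of_le_one_right (Real.exp_nonneg _) (by linarith))
  have h3 := Real.posLog_norm_add_le (f (circleMap 0 r θ) - f (circleMap 0 r₀ θ))
    (f (circleMap 0 r₀ θ))
  rw [sub_add_cancel] at h3
  have h4 : Real.posLog ‖f (circleMap 0 r θ) - f (circleMap 0 r₀ θ)‖ ≤ w := by
    refine (Real.posLog_le_posLog (norm_nonneg _) h2).trans ?_
    rw [Real.posLog_apply, Real.log_exp, max_eq_right hw0]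
  linarith

/-- The characteristic of `f` is bounded by that of `f'` up to a logarithmic factor. -/
theorem logComparable_nevanlinnaT_deriv {f : ℂ → ℂ} (hf : MeromorphicOn f (ball 0 1)) :
    LogComparable (nevanlinnaT f) (nevanlinnaT (deriv f)) := by
  obtain ⟨r₀, hr₀, hr₁, han⟩ := (hf 0 (by simp)).exists_forall_analyticAt
  have hf' : MeromorphicOn (deriv f) (ball 0 1) := hf.deriv
  obtain ⟨C, hC, hmaj⟩ := exists_majorant hf' hr₀ hr₁ fun z hz hzr => (han z hz hzr).deriv
  -- Integration along radii starts on |z| = r₀, where f is analytic, because 0 itself may be a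
  -- pole.
  obtain ⟨M, hM⟩ : ∃ M, ∀ z ∈ sphere (0 : ℂ) r₀, Real.posLog ‖f z‖ ≤ M := by
    refine ((isCompact_sphere (0 : ℂ) r₀).bddAbove_image (f := fun z => Real.posLog ‖f z‖) ?_).imp
      fun M hM z hz => hM ⟨z, hz, rfl⟩
    refine Real.continuous_posLog.comp_continuousOn (ContinuousOn.norm fun z hz => ?_)
    have hz' : ‖z‖ = r₀ := by simpa using hz
    refine (han z ?_ hz'.le).continuousAt.continuousWithinAt
    rintro rfl
    rw [norm_zero] at hz'
    exact hr₀.ne hz'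
  have hM0 : 0 ≤ M := Real.posLog_nonneg.trans (hM (circleMap 0 r₀ 0)
    (circleMap_mem_sphere 0 hr₀.le 0))
  have hlog2 := Real.log_nonneg one_le_two
  set n₀ : ℝ := (poleOrder (deriv f) 0 : ℝ) with hn₀
  have hn₀' : 0 ≤ n₀ * Real.log 2 := mul_nonneg (by positivity) hlog2
  refine LogComparable.of_le (C := C + 1 + (M + Real.log 2 + n₀ * Real.log 2)) ?_
    (eventually_neg_one_le_nevanlinnaT hf)
  filter_upwards [hmaj, tendsto_log_four_div.eventually_ge_atTop 1, self_mem_nhdsWithin,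
    mem_nhdsWithin_of_mem_nhds (Ioi_mem_nhds (show (1 / 2 : ℝ) < 1 by norm_num))]
    with r hmaj hL hr1 hr0
  have hr1 : r < 1 := hr1
  have hr0 : 1 / 2 < r := hr0
  set R := (1 + r) / 2 with hRdef
  set L := Real.log (4 / (1 - r))
  have hfr : MeromorphicOn f (closedBall 0 r) := hf.mono_set (closedBall_subset_ball hr1)
  have hfR' : MeromorphicOn (deriv f) (closedBall 0 R) :=
    hf'.mono_set (closedBall_subset_ball (by rw [hRdef]; linarith))
  obtain ⟨S, hS⟩ := exists_finset_poles hfR'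
  obtain ⟨W, hW, hWb⟩ := hmaj S hS
  have hTabs := abs_nonneg (nevanlinnaT (deriv f) R)
  have hm : ValueDistribution.proximity f ⊤ r ≤ (M + Real.log 2) +
      1 * (C * L * (|nevanlinnaT (deriv f) R| + C)) := by
    refine proximity_le_of_ae_le ?_ (by positivity) (by positivity) zero_le_one hW ?_
    · rw [abs_of_pos (by linarith)]
      exact hfr.mono_set sphere_subset_closedBall
    filter_upwards [hWb, hf.ae_analyticAt_circleMap, hf'.ae_analyticAt_circleMap]
      with θ h1 h2 h3
    rw [ENNReal.ofReal_one, one_mul]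
    -- Where the majorant is infinite there is nothing to prove; elsewhere its value bounds log⁺|f'|
    -- on the whole segment.
    by_cases htop : W θ = ⊤
    · simp [htop]
    have hw : ∀ t, r₀ ≤ t → t ≤ r → Real.posLog ‖deriv f (circleMap 0 t θ)‖ ≤ (W θ).toReal := by
      intro t ht htr
      refine (ENNReal.ofReal_le_iff_le_toReal htop).1 (le_trans ?_ (h1 t ht htr))
      refine ENNReal.ofReal_le_ofReal (posLog_norm_le_poissonPosLog_add hfR' hS ?_
        (h3 t (by linarith) (by linarith)))
      simp only [mem_ball, dist_zero_right, norm_circleMap_zero,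
        abs_of_nonneg (by linarith : 0 ≤ t)]
      rw [hRdef]
      linarith
    have h4 := posLog_norm_le_of_posLog_norm_deriv_le hr₀.le (by linarith) hr1.le
      (fun t ht htr => h2 t (by linarith) (by linarith))
      (hM _ (circleMap_mem_sphere 0 hr₀.le θ)) ENNReal.toReal_nonneg hw
    calc ENNReal.ofReal (Real.posLog ‖f (circleMap 0 r θ)‖)
        ≤ ENNReal.ofReal ((M + Real.log 2) + (W θ).toReal) :=
          ENNReal.ofReal_le_ofReal (by linarith)
      _ ≤ _ := by
          refine ENNReal.ofReal_add_le.trans ?_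
          rw [ENNReal.ofReal_toReal htop]
  have hN := poleCounting_le (k := 1) (by linarith : 0 < r) (by rw [hRdef]; linarith : r ≤ R)
    (by rw [hRdef]; linarith) hr1.le hfr hfR'
    (fun b _ => by rw [one_mul]; exact poleOrder_le_poleOrder_deriv b)
  have hm' := proximity_top_nonneg (deriv f) R
  have hT : poleCounting (deriv f) R ≤ |nevanlinnaT (deriv f) R| := by
    refine le_trans ?_ (le_abs_self _)
    unfold nevanlinnaT
    linarith
  rw [Nat.cast_one, one_mul, ← hn₀] at hN
  unfold nevanlinnaT at *
  set T := |ValueDistribution.proximity (deriv f) ⊤ R + poleCounting (deriv f) R|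
  set D := M + Real.log 2 + n₀ * Real.log 2 with hD
  have hD0 : 0 ≤ D := by positivity
  have e1 : T + D ≤ L * (T + D) := le_mul_of_one_le_left (by positivity) hL
  have e2 : L * (C * (T + C) + (T + D)) ≤ L * ((C + 1 + D) * (T + (C + 1 + D))) := by
    refine mul_le_mul_of_nonneg_left ?_ (by linarith)
    nlinarith [mul_nonneg hC hTabs, mul_nonneg hC hD0, mul_nonneg hD0 hTabs, mul_nonneg hD0 hD0]
  calc _ ≤ L * (C * (T + C) + (T + D)) := by linarith
    _ ≤ _ := e2.trans (le_of_eq (by ring))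

/-! ### Bounding the characteristic of f' by that of f. -/

/-- The finite Blaschke product of the disc of radius `R` with zeros of order `poleOrder f b` at the
points `b` of `S`. -/
noncomputable def poleBlaschke (f : ℂ → ℂ) (R : ℝ) (S : Finset ℂ) (z : ℂ) : ℂ :=
  ∏ b ∈ S, (Complex.canonicalFactor R b z)⁻¹ ^ poleOrder f b

theorem analyticAt_inv_canonicalFactor {R : ℝ} {b z : ℂ} (hb : ‖b‖ ≤ R) (hz : z ∈ ball (0 : ℂ) R) :
    AnalyticAt ℂ (fun z => (Complex.canonicalFactor R b z)⁻¹) z := by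
  have hR : 0 < R := pos_of_mem_ball hz
  have hz' : ‖z‖ < R := by simpa using hz
  have hne : (R : ℂ) ^ 2 - (starRingEnd ℂ) b * z ≠ 0 := by
    intro h
    have h1 : ‖(R : ℂ) ^ 2‖ = ‖(starRingEnd ℂ) b * z‖ := by rw [sub_eq_zero.1 h]
    rw [norm_pow, Complex.norm_real, Real.norm_eq_abs, sq_abs, norm_mul, RCLike.norm_conj] at h1
    nlinarith [norm_nonneg b, norm_nonneg z]
  simp only [Complex.canonicalFactor_apply, inv_div]
  fun_prop (disch := exact hne)

theorem analyticAt_poleBlaschke {f : ℂ → ℂ} {R : ℝ} {S : Finset ℂ} (hS : ∀ b ∈ S, ‖b‖ ≤ R) {z : ℂ}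
    (hz : z ∈ ball (0 : ℂ) R) : AnalyticAt ℂ (poleBlaschke f R S) z := by
  unfold poleBlaschke
  exact Finset.analyticAt_fun_prod _ fun b hb => (analyticAt_inv_canonicalFactor (hS b hb) hz).pow _

theorem norm_poleBlaschke_le_one {f : ℂ → ℂ} {R : ℝ} {S : Finset ℂ} (hS : ∀ b ∈ S, ‖b‖ ≤ R) {z : ℂ}
    (hz : z ∈ ball (0 : ℂ) R) : ‖poleBlaschke f R S z‖ ≤ 1 := by
  have hR : 0 < R := pos_of_mem_ball hz
  rw [poleBlaschke, norm_prod]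
  refine Finset.prod_le_one (fun _ _ => norm_nonneg _) fun b hb => ?_
  rw [norm_pow, norm_inv]
  refine pow_le_one₀ (by positivity) ?_
  rcases eq_or_ne z b with rfl | h
  · simp
  · exact inv_le_one_of_one_le₀
      (one_le_norm_canonicalFactor hR (hS b hb) (by simpa using ball_subset_closedBall hz) h)

theorem norm_poleBlaschke_eq_exp {f : ℂ → ℂ} {R : ℝ} {S : Finset ℂ} (hS : ∀ b ∈ S, ‖b‖ ≤ R) {z : ℂ}
    (hz : z ∈ ball (0 : ℂ) R) (hzS : z ∉ S) :
    ‖poleBlaschke f R S z‖ =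
      Real.exp (-∑ b ∈ S, poleOrder f b * Real.log ‖Complex.canonicalFactor R b z‖) := by
  have hR : 0 < R := pos_of_mem_ball hz
  rw [poleBlaschke, norm_prod, ← Finset.sum_neg_distrib, Real.exp_sum]
  refine Finset.prod_congr rfl fun b hb => ?_
  have hne : z ≠ b := fun h => hzS (h ▸ hb)
  have h1 := one_le_norm_canonicalFactor hR (hS b hb) (by simpa using ball_subset_closedBall hz) hne
  rw [norm_pow, norm_inv, ← mul_neg, Real.exp_nat_mul, Real.exp_neg, Real.exp_log (by linarith)]

/-- At a pole z, the factor belonging to z vanishes to exactly the order of the pole, and the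
remaining factors are analytic. -/
theorem meromorphicOrderAt_poleBlaschke_mul_nonneg {f : ℂ → ℂ} {R : ℝ} {S : Finset ℂ}
    (hf : MeromorphicOn f (closedBall 0 R)) (hS : ∀ b, b ∈ S ↔ ‖b‖ ≤ R ∧ poleOrder f b ≠ 0) {z : ℂ}
    (hz : z ∈ ball (0 : ℂ) R) : 0 ≤ meromorphicOrderAt (poleBlaschke f R S * f) z := by
  have hS' : ∀ b ∈ S, ‖b‖ ≤ R := fun b hb => ((hS b).1 hb).1
  have hfz := hf z (ball_subset_closedBall hz)
  have hB := analyticAt_poleBlaschke (f := f) hS' hz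
  rw [meromorphicOrderAt_mul hB.meromorphicAt hfz]
  by_cases h0 : 0 ≤ meromorphicOrderAt f z
  · exact add_nonneg hB.meromorphicOrderAt_nonneg h0
  obtain ⟨n, hn⟩ : ∃ n : ℤ, meromorphicOrderAt f z = n :=
    ⟨_, (WithTop.coe_untop₀_of_ne_top fun h => h0 (by simp [h])).symm⟩
  have hn0 : n < 0 := by
    rw [hn] at h0
    push Not at h0
    exact_mod_cast h0
  have hpo : (poleOrder f z : ℤ) = -n := by
    rw [poleOrder, hn, WithTop.untop₀_coe]
    omega
  have hzS : z ∈ S := (hS z).2 ⟨by simpa using ball_subset_closedBall hz, by omega⟩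
  have hsplit : poleBlaschke f R S = (fun w => (Complex.canonicalFactor R z w)⁻¹) ^ poleOrder f z *
      poleBlaschke f R (S.erase z) := by
    funext w
    simp only [poleBlaschke, Pi.mul_apply, Pi.pow_apply]
    exact (Finset.mul_prod_erase S (fun b => (Complex.canonicalFactor R b w)⁻¹ ^ poleOrder f b)
      hzS).symm
  have hfac := analyticAt_inv_canonicalFactor (hS' z hzS) hz
  have hrest : AnalyticAt ℂ (poleBlaschke f R (S.erase z)) z :=
    analyticAt_poleBlaschke (fun b hb => hS' b (Finset.mem_of_mem_erase hb)) hz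
  have hord : meromorphicOrderAt (fun w => (Complex.canonicalFactor R z w)⁻¹) z = 1 := by
    have := meromorphicOrderAt_inv (f := Complex.canonicalFactor R z) (x := z)
    rw [Complex.meromorphicOrderAt_canonicalFactor hz] at this
    exact this
  rw [hsplit, meromorphicOrderAt_mul (hfac.meromorphicAt.pow _) hrest.meromorphicAt,
    meromorphicOrderAt_pow hfac.meromorphicAt, hord, hn]
  have h1 := hrest.meromorphicOrderAt_nonneg
  have h2 : ((poleOrder f z : WithTop ℤ) * 1) + (n : WithTop ℤ) = 0 := by
    have : (poleOrder f z : WithTop ℤ) = ((poleOrder f z : ℤ) : WithTop ℤ) := by simp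
    rw [mul_one, this, hpo]
    exact_mod_cast neg_add_cancel n
  calc (0 : WithTop ℤ) ≤ meromorphicOrderAt (poleBlaschke f R (S.erase z)) z := h1
    _ = ((poleOrder f z : WithTop ℤ) * 1) + n +
        meromorphicOrderAt (poleBlaschke f R (S.erase z)) z := by rw [h2, zero_add]
    _ = _ := by rw [add_right_comm]

/-- Harnack's inequality: moving by less than κ at distance at least 2κ from the circle multiplies
the numerator by at most 3 and at most halves the distance to ζ, whence 3 · 4. -/
theorem poissonKernel_le_twelve_mul {R κ : ℝ} {z w ζ : ℂ} (hz : ‖z‖ ≤ R - 2 * κ)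
    (hw : ‖w - z‖ < κ) (hζ : ζ ∈ sphere (0 : ℂ) R) :
    poissonKernel 0 w ζ ≤ 12 * poissonKernel 0 z ζ := by
  have hκ : 0 < κ := (norm_nonneg _).trans_lt hw
  have hζ' : ‖ζ‖ = R := by simpa using hζ
  have hwz : ‖w‖ ≤ ‖z‖ + ‖w - z‖ := by
    have := norm_add_le z (w - z)
    rwa [add_sub_cancel] at this
  have hzw : ‖z‖ ≤ ‖w‖ + ‖w - z‖ := by
    have := norm_sub_le w (w - z)
    rwa [sub_sub_cancel] at this
  have h1 : R - ‖w‖ ≤ ‖ζ - w‖ := by rw [← hζ']; exact norm_sub_norm_le _ _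
  have h2 : ‖ζ - z‖ ≤ ‖ζ - w‖ + ‖w - z‖ := by
    have := norm_add_le (ζ - w) (w - z)
    rwa [sub_add_sub_cancel] at this
  have h3 : R - ‖z‖ ≤ ‖ζ - z‖ := by rw [← hζ']; exact norm_sub_norm_le _ _
  have h4 : ‖ζ - z‖ ≤ 2 * ‖ζ - w‖ := by linarith
  have hz0 := norm_nonneg z
  have hw0 := norm_nonneg w
  simp only [poissonKernel_def, sub_zero, hζ']
  have hdz : 0 < ‖ζ - z‖ := by linarith
  have hdw : 0 < ‖ζ - w‖ := by linarith
  rw [← mul_div_assoc, div_le_div_iff₀ (by positivity) (by positivity)]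
  have h5 : R ^ 2 - ‖w‖ ^ 2 ≤ 3 * (R ^ 2 - ‖z‖ ^ 2) := by nlinarith
  have h6 : ‖ζ - z‖ ^ 2 ≤ 4 * ‖ζ - w‖ ^ 2 := by nlinarith
  have h7 : 0 ≤ R ^ 2 - ‖z‖ ^ 2 := by nlinarith
  calc (R ^ 2 - ‖w‖ ^ 2) * ‖ζ - z‖ ^ 2 ≤ (3 * (R ^ 2 - ‖z‖ ^ 2)) * ‖ζ - z‖ ^ 2 :=
        mul_le_mul_of_nonneg_right h5 (by positivity)
    _ ≤ (3 * (R ^ 2 - ‖z‖ ^ 2)) * (4 * ‖ζ - w‖ ^ 2) :=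
        mul_le_mul_of_nonneg_left h6 (by positivity)
    _ = _ := by ring

theorem poissonPosLog_le_twelve_mul {f : ℂ → ℂ} {R κ : ℝ} {z w : ℂ}
    (hf : MeromorphicOn f (closedBall 0 R)) (hz : ‖z‖ ≤ R - 2 * κ) (hw : ‖w - z‖ < κ) :
    poissonPosLog f R w ≤ 12 * poissonPosLog f R z := by
  have hκ : 0 < κ := (norm_nonneg _).trans_lt hw
  have hwz : ‖w‖ ≤ ‖z‖ + ‖w - z‖ := by
    have := norm_add_le z (w - z)
    rwa [add_sub_cancel] at this
  have hzR : z ∈ ball (0 : ℂ) R := by simp; linarith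
  have hwR : w ∈ ball (0 : ℂ) R := by simp; linarith
  have hR : 0 < R := pos_of_mem_ball hzR
  have hsph : MeromorphicOn f (sphere 0 |R|) := by
    rw [abs_of_pos hR]
    exact hf.mono_set sphere_subset_closedBall
  have hint := circleIntegrable_posLog_norm hsph
  unfold poissonPosLog
  rw [← smul_eq_mul (12 : ℝ), ← Real.circleAverage_fun_smul]
  refine Real.circleAverage_mono (CircleIntegrable.poissonKernel_mul hwR hint)
    ((CircleIntegrable.poissonKernel_mul hzR hint).const_smul) fun ζ hζ => ?_
  rw [abs_of_pos hR] at hζ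
  rw [smul_eq_mul, ← mul_assoc]
  exact mul_le_mul_of_nonneg_right (poissonKernel_le_twelve_mul hz hw hζ) Real.posLog_nonneg

/-- Pointwise bound of the derivative of a meromorphic function by the right-hand side of the
Poisson–Jensen inequality for the function itself. -/
theorem posLog_norm_deriv_le {f : ℂ → ℂ} {R κ : ℝ} {S : Finset ℂ} (hκ : 0 < κ) (hκ1 : κ ≤ 1)
    (hf : MeromorphicOn f (closedBall 0 R)) (hS : ∀ b, b ∈ S ↔ ‖b‖ ≤ R ∧ poleOrder f b ≠ 0) {z : ℂ}
    (hz : ‖z‖ ≤ R - 2 * κ) (hfz : AnalyticAt ℂ f z) :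
    Real.posLog ‖deriv f z‖ ≤ Real.log (4 / κ) + 12 * (poissonPosLog f R z +
      ∑ b ∈ S, poleOrder f b * Real.log ‖Complex.canonicalFactor R b z‖) := by
  have hS' : ∀ b ∈ S, ‖b‖ ≤ R := fun b hb => ((hS b).1 hb).1
  have hball : ball z κ ⊆ ball (0 : ℂ) R := fun w hw => by
    have h1 : ‖w - z‖ < κ := by simpa [dist_eq_norm] using hw
    have := norm_add_le z (w - z)
    rw [add_sub_cancel] at this
    simp only [mem_ball, dist_zero_right]
    linarith
  have hzR : z ∈ ball (0 : ℂ) R := hball (mem_ball_self hκ)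
  have hR : 0 < R := pos_of_mem_ball hzR
  have hmero : MeromorphicOn (poleBlaschke f R S * f) (ball 0 R) := fun w hw =>
    (analyticAt_poleBlaschke hS' hw).meromorphicAt.mul (hf w (ball_subset_closedBall hw))
  set B := poleBlaschke f R S with hB
  -- h is B f with its removable singularities filled in, hence analytic on the disc.
  set h := toMeromorphicNFOn (B * f) (ball 0 R) with hh
  set u := poissonPosLog f R z
  set s := ∑ b ∈ S, (poleOrder f b : ℝ) * Real.log ‖Complex.canonicalFactor R b z‖
  have hu : 0 ≤ u := poissonPosLog_nonneg hzR
  have hs : 0 ≤ s := Finset.sum_nonneg fun b hb => mul_nonneg (by positivity)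
    (log_norm_canonicalFactor_nonneg hR (hS' b hb) (by simpa using ball_subset_closedBall hzR))
  have hnotS : ∀ w, AnalyticAt ℂ f w → w ∉ S := fun w hw hwS =>
    ((hS w).1 hwS).2 hw.poleOrder_eq_zero
  have hhan : ∀ w ∈ ball (0 : ℂ) R, AnalyticAt ℂ h w := fun w hw => by
    have hNF := meromorphicNFOn_toMeromorphicNFOn (B * f) (ball 0 R) hw
    rw [← hNF.meromorphicOrderAt_nonneg_iff_analyticAt,
      meromorphicOrderAt_toMeromorphicNFOn hmero hw]
    exact meromorphicOrderAt_poleBlaschke_mul_nonneg hf hS hw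
  have hgen : ∀ w ∈ ball z κ, AnalyticAt ℂ f w → ‖(B * f) w‖ ≤ Real.exp (12 * u) := by
    intro w hw hfw
    have hwR := hball hw
    rcases eq_or_ne (f w) 0 with h0 | h0
    · simp only [Pi.mul_apply, h0, mul_zero, norm_zero]
      positivity
    have h1 := log_norm_add_sum_le_poissonPosLog hf hS hwR hfw h0
    have h2 := poissonPosLog_le_twelve_mul (w := w) hf hz (by simpa [dist_eq_norm] using hw)
    have h3 : ‖f w‖ ≤ Real.exp (poissonPosLog f R w +
        ∑ b ∈ S, poleOrder f b * Real.log ‖Complex.canonicalFactor R b w‖) :=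
      (Real.log_le_iff_le_exp (norm_pos_iff.2 h0)).1 h1
    rw [Pi.mul_apply, norm_mul, hB, norm_poleBlaschke_eq_exp hS' hwR (hnotS w hfw)]
    refine (mul_le_mul_of_nonneg_left h3 (Real.exp_nonneg _)).trans ?_
    rw [← Real.exp_add]
    exact Real.exp_le_exp.2 (by linarith)
  have hbound : ∀ w ∈ ball z κ, ‖h w‖ ≤ Real.exp (12 * u) := by
    intro w hw
    have hwR := hball hw
    -- Points where f is analytic fill a punctured neighbourhood of w, so the bound passes to w by
    -- continuity of h, even if w is a pole of f.
    have hcont : Tendsto (fun x => ‖h x‖) (𝓝[≠] w) (𝓝 ‖h w‖) :=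
      (hhan w hwR).continuousAt.norm.tendsto.mono_left nhdsWithin_le_nhds
    refine le_of_tendsto hcont ?_
    filter_upwards [hmero.toMeromorphicNFOn_eq_self_on_nhdsNE hwR,
      (hf w (ball_subset_closedBall hwR)).eventually_analyticAt,
      mem_nhdsWithin_of_mem_nhds (isOpen_ball.mem_nhds hw)] with x h1 h2 h3
    rw [hh, h1]
    exact hgen x h3 h2
  have hsphere : closedBall z (κ / 2) ⊆ ball z κ := closedBall_subset_ball (by linarith)
  have hd1 : ‖deriv h z‖ ≤ Real.exp (12 * u) / (κ / 2) := by
    refine Complex.norm_deriv_le_of_forall_mem_sphere_norm_le (by linarith) ?_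
      fun w hw => hbound w (hsphere (sphere_subset_closedBall hw))
    refine DifferentiableOn.diffContOnCl_ball (U := ball z κ) (fun w hw => ?_) hsphere
    exact (hhan w (hball hw)).differentiableAt.differentiableWithinAt
  have hd2 : ‖deriv B z‖ ≤ 1 / (κ / 2) := by
    refine Complex.norm_deriv_le_of_forall_mem_sphere_norm_le (by linarith) ?_
      fun w hw => norm_poleBlaschke_le_one hS' (hball (hsphere (sphere_subset_closedBall hw)))
    refine DifferentiableOn.diffContOnCl_ball (U := ball z κ) (fun w hw => ?_) hsphere
    exact (analyticAt_poleBlaschke hS' (hball hw)).differentiableAt.differentiableWithinAt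
  have hBz := analyticAt_poleBlaschke (f := f) hS' hzR
  have heq : h =ᶠ[𝓝 z] B * f := by
    refine eventuallyEq_nhds_of_eventuallyEq_nhdsNE
      (hmero.toMeromorphicNFOn_eq_self_on_nhdsNE hzR) ?_
    rw [hh, toMeromorphicNFOn_eq_toMeromorphicNFAt hmero hzR,
      toMeromorphicNFAt_eq_self.2 (hBz.mul hfz).meromorphicNFAt]
  have hderiv : deriv h z = deriv B z * f z + B z * deriv f z := by
    rw [heq.deriv_eq]
    exact deriv_mul hBz.differentiableAt hfz.differentiableAt
  have hfbound : ‖f z‖ ≤ Real.exp (u + s) := by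
    have h1 : Real.posLog ‖f z‖ ≤ u + s := posLog_norm_le_poissonPosLog_add hf hS hzR hfz
    rw [Real.posLog_eq_log_max_one (norm_nonneg _), Real.log_le_iff_le_exp (by positivity)] at h1
    exact (le_max_right _ _).trans h1
  have hBnorm : ‖B z‖ = Real.exp (-s) := norm_poleBlaschke_eq_exp hS' hzR (hnotS z hfz)
  have hmain : Real.exp (-s) * ‖deriv f z‖ ≤ 4 / κ * Real.exp (12 * u + s) := by
    -- The product rule is solved for B f'. Cauchy's estimate on the circle of radius κ/2 gives a
    -- factor 2/κ for each of the two terms; dividing by |B(z)| = exp(-s) afterwards adds a second s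
    -- to the exponent.
    have h1 : B z * deriv f z = deriv h z - deriv B z * f z := by rw [hderiv]; ring
    rw [← hBnorm, ← norm_mul, h1]
    refine (norm_sub_le _ _).trans ?_
    rw [norm_mul]
    have h2 : Real.exp (12 * u) ≤ Real.exp (12 * u + s) := Real.exp_le_exp.2 (by linarith)
    have h3 : Real.exp (u + s) ≤ Real.exp (12 * u + s) := Real.exp_le_exp.2 (by linarith)
    have h4 : ‖deriv B z‖ * ‖f z‖ ≤ 1 / (κ / 2) * Real.exp (12 * u + s) :=
      mul_le_mul hd2 (hfbound.trans h3) (norm_nonneg _) (by positivity)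
    have h5 : Real.exp (12 * u) / (κ / 2) ≤ Real.exp (12 * u + s) / (κ / 2) := by gcongr
    calc ‖deriv h z‖ + ‖deriv B z‖ * ‖f z‖ ≤ Real.exp (12 * u + s) / (κ / 2) +
          1 / (κ / 2) * Real.exp (12 * u + s) := by linarith
      _ = _ := by ring
  have hfin : ‖deriv f z‖ ≤ 4 / κ * Real.exp (12 * (u + s)) := by
    have h1 : ‖deriv f z‖ = Real.exp s * (Real.exp (-s) * ‖deriv f z‖) := by
      rw [← mul_assoc, ← Real.exp_add, add_neg_cancel, Real.exp_zero, one_mul]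
    rw [h1]
    refine (mul_le_mul_of_nonneg_left hmain (Real.exp_nonneg _)).trans ?_
    rw [mul_left_comm, ← Real.exp_add]
    refine mul_le_mul_of_nonneg_left (Real.exp_le_exp.2 (by linarith)) (by positivity)
  refine (Real.posLog_le_posLog (norm_nonneg _) hfin).trans ?_
  have h4κ : 1 ≤ 4 / κ := by rw [le_div_iff₀ hκ]; linarith
  have hexp : 1 ≤ Real.exp (12 * (u + s)) := Real.one_le_exp (by positivity)
  rw [Real.posLog_eq_log, Real.log_mul (by positivity) (by positivity), Real.log_exp]
  rw [abs_of_nonneg (by positivity)]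
  exact one_le_mul_of_one_le_of_one_le h4κ hexp

/-- The characteristic of `f'` is bounded by that of `f` up to a logarithmic factor. -/
theorem logComparable_deriv_nevanlinnaT {f : ℂ → ℂ} (hf : MeromorphicOn f (ball 0 1)) :
    LogComparable (nevanlinnaT (deriv f)) (nevanlinnaT f) := by
  obtain ⟨r₀, hr₀, hr₁, han⟩ := (hf 0 (by simp)).exists_forall_analyticAt
  have hf' : MeromorphicOn (deriv f) (ball 0 1) := hf.deriv
  obtain ⟨C, hC, hmaj⟩ := exists_majorant hf hr₀ hr₁ han
  have hlog2 := Real.log_nonneg one_le_two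
  set n₀ : ℝ := (poleOrder f 0 : ℝ) with hn₀
  have hn₀' : 0 ≤ n₀ * Real.log 2 := mul_nonneg (by positivity) hlog2
  refine LogComparable.of_le (C := 12 * C + 4 + 2 * (n₀ * Real.log 2)) ?_
    (eventually_neg_one_le_nevanlinnaT hf')
  filter_upwards [hmaj, tendsto_log_four_div.eventually_ge_atTop 1, self_mem_nhdsWithin,
    mem_nhdsWithin_of_mem_nhds (Ioi_mem_nhds (show (1 / 2 : ℝ) < 1 by norm_num))]
    with r hmaj hL hr1 hr0
  have hr1 : r < 1 := hr1
  have hr0 : 1 / 2 < r := hr0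
  set R := (1 + r) / 2 with hRdef
  set κ := (1 - r) / 4 with hκdef
  have hκ : 0 < κ := by rw [hκdef]; linarith
  have hκ1 : κ ≤ 1 := by rw [hκdef]; linarith
  -- The circle |z| = r is exactly at the distance 2κ from |z| = R required by the pointwise bound.
  have hrκ : r = R - 2 * κ := by rw [hRdef, hκdef]; ring
  have h4κ : Real.log (4 / κ) ≤ 2 * Real.log (4 / (1 - r)) := by
    have e : Real.log (4 / κ) = Real.log 4 + Real.log (4 / (1 - r)) := by
      rw [← Real.log_mul (by norm_num) (div_ne_zero (by norm_num) (by linarith))]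
      congr 1
      rw [hκdef]
      field_simp
    have : Real.log 4 ≤ Real.log (4 / (1 - r)) := by
      refine Real.log_le_log (by norm_num) ?_
      rw [le_div_iff₀ (by linarith)]
      linarith
    linarith
  set L := Real.log (4 / (1 - r))
  have hfr' : MeromorphicOn (deriv f) (closedBall 0 r) :=
    hf'.mono_set (closedBall_subset_ball hr1)
  have hfR : MeromorphicOn f (closedBall 0 R) :=
    hf.mono_set (closedBall_subset_ball (by rw [hRdef]; linarith))
  obtain ⟨S, hS⟩ := exists_finset_poles hfR
  obtain ⟨W, hW, hWb⟩ := hmaj S hS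
  have hTabs := abs_nonneg (nevanlinnaT f R)
  have hm : ValueDistribution.proximity (deriv f) ⊤ r ≤ 2 * L +
      12 * (C * L * (|nevanlinnaT f R| + C)) := by
    refine proximity_le_of_ae_le ?_ (by positivity) (by positivity) (by norm_num) hW ?_
    · rw [abs_of_pos (by linarith)]
      exact hfr'.mono_set sphere_subset_closedBall
    filter_upwards [hWb, hf.ae_analyticAt_circleMap] with θ h1 h2
    have h3 := posLog_norm_deriv_le (z := circleMap 0 r θ) hκ hκ1 hfR hS
      (by rw [norm_circleMap_zero, abs_of_pos (by linarith), hrκ]) (h2 r (by linarith) hr1)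
    refine (ENNReal.ofReal_le_ofReal (h3.trans (add_le_add_left h4κ _))).trans ?_
    refine ENNReal.ofReal_add_le.trans (add_le_add le_rfl ?_)
    rw [ENNReal.ofReal_mul (by norm_num)]
    gcongr
    exact h1 r (by linarith) le_rfl
  have hN := poleCounting_le (k := 2) (by linarith : 0 < r) (by rw [hRdef]; linarith : r ≤ R)
    (by rw [hRdef]; linarith) hr1.le hfr' hfR (fun b hb =>
      poleOrder_deriv_le (hf b (closedBall_subset_ball hr1 hb)))
  have hm' := proximity_top_nonneg f R
  have hT : poleCounting f R ≤ |nevanlinnaT f R| := by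
    refine le_trans ?_ (le_abs_self _)
    unfold nevanlinnaT
    linarith
  rw [← hn₀] at hN
  push_cast at hN
  unfold nevanlinnaT at *
  set T := |ValueDistribution.proximity f ⊤ R + poleCounting f R|
  set D := n₀ * Real.log 2 with hD
  have e1 : 2 * (T + D) ≤ L * (2 * (T + D)) := le_mul_of_one_le_left (by positivity) hL
  have e2 : L * (2 + 12 * (C * (T + C)) + 2 * (T + D)) ≤
      L * ((12 * C + 4 + 2 * D) * (T + (12 * C + 4 + 2 * D))) := by
    refine mul_le_mul_of_nonneg_left ?_ (by linarith)
    nlinarith [mul_nonneg hC hTabs, mul_nonneg hC hn₀', mul_nonneg hn₀' hTabs,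
      mul_nonneg hn₀' hn₀', mul_nonneg hC hC]
  calc _ ≤ L * (2 + 12 * (C * (T + C)) + 2 * (T + D)) := by linarith
    _ ≤ _ := e2.trans (le_of_eq (by ring))

theorem lemma3p5 (α β γ : ℝ → ℝ) (hαβγ : GrowthTriple α β γ) (f : ℂ → ℂ)
    (hf : MeromorphicOn f (Metric.ball 0 1)) :
    growthOrder α β γ (deriv f) = growthOrder α β γ f ∧
      growthOrderLog α β γ (deriv f) = growthOrderLog α β γ f := by
  obtain ⟨h1, h2⟩ := hαβγ.orders_le (logComparable_deriv_nevanlinnaT hf)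
  obtain ⟨h3, h4⟩ := hαβγ.orders_le (logComparable_nevanlinnaT_deriv hf)
  exact ⟨le_antisymm h1 h3, le_antisymm h2 h4⟩
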